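/- Let $\mathcal G$ be a Hausdorff étale groupoid whose unit space $\mathcal G^{(0)}$ is a Cantor space (a Cantor groupoid). A compact open bisection is a compact open set $B\subseteq\mathcal G$ on which the source map $s$ and the range map $r$ restrict to homeomorphisms onto open subsets of $\mathcal G^{(0)}$. Assume that $\mathcal G$ is - effective: whenever $x\in\mathcal G^{(0)}$, $\gamma\neq x$ satisfies $s(\gamma)=r(\gamma)=x$, and $B$ is a compact open bisection containing $\gamma$, there is $\gamma'\in B$ with $s(\gamma')\neq r(\gamma')$; - minimal: for every $x\in\mathcal G^{(0)}$ the orbit $\{r(\gamma): s(\gamma)=x\}$ is dense in $\mathcal G^{(0)}$; - purely infinite: for every compact open $K\subseteq\mathcal G^{(0)}$ there are compact open bisections $B,B'$ with $s(B)=s(B')=K$ such that $r(B)$ and $r(B')$ are disjoint subsets of $K$. Let $\mathsf F(\mathcal G)\le \mathrm{Homeo}(\mathcal G^{(0)})$ be the topological full group, that is, the group of homeomorphisms $g$ for which there is a compact open bisection $B$ with $s(B)=r(B)=\mathcal G^{(0)}$ and $g(s(\gamma))=r(\gamma)$ for all $\gamma\in B$. Let $\mathsf D(\mathcal G)$ be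 its commutator subgroup and $\pi_{\mathrm{ab}}\colon \mathsf F(\mathcal G)\to\mathsf F(\mathcal G)_{\mathrm{ab}}=\mathsf F(\mathcal G)/\mathsf D(\mathcal G)$ the quotient map. A character of a group $\Gamma$ is a function $\chi\colon\Gamma\to\mathbb C$ with $\chi(1)=1$ and $\chi(gh)=\chi(hg)$ for all $g,h$, such that all matrices $(\chi(g_ig_j^{-1}))_{i,j=1}^n$ with $g_1,\dots,g_n\in\Gamma$ are positive semidefinite. It is indecomposable if it is not of the form $t\chi_1+(1-t)\chi_2$ with $0<t<1$ and characters $\chi_1\neq\chi_2$. The regular character is the one with $\chi(g)=0$ for all $g\neq1$. A unitary representation $\pi$ of $\Gamma$ on a complex Hilbert space $H$ is a finite factor representation if $M_\pi=\pi(\Gamma)''$ is a finite factor, that is, $M_\pi\cap M_\pi'=\mathbb C\,\mathrm{id}_H$ and $M_\pi$ has a faithful normal tracial state $\tau$; the function $\tau\circ\pi$ is then called the character of $\pi$. (1) Every indecomposable character $\chi$ of $\mathsf F(\mathcal G)$ is either the regular character or of the form $\chi=\rho\circ\pi_{\mathrm{ab}}$ for some group homomorphism $\rho\colon\mathsf F(\mathcal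 G)_{\mathrm{ab}}\to\mathbb T$. (2) Every finite factor representation $\pi$ of $\mathsf F(\mathcal G)$ on a Hilbert space $H$ either has the regular character as its character, or is of the form $\pi(g)=\rho(\pi_{\mathrm{ab}}(g))\,\mathrm{id}_H$ for all $g\in\mathsf F(\mathcal G)$, for some group homomorphism $\rho\colon\mathsf F(\mathcal G)_{\mathrm{ab}}\to\mathbb T$. -/

import Mathlib

open CategoryTheory Topology
open scoped InnerProductSpace ComplexOrder

universe u v w

/-! ## Topological groupoids

A groupoid is a Mathlib `Groupoid` structure on its unit space `X`; its underlying set of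
elements is the type `Quiver.Total X` of all arrows. An arrow `γ : x ⟶ y` has source `x = γ.left`
and range `y = γ.right`, and the product `γ₁ γ₂` (defined when `s γ₁ = r γ₂`) is `γ₂ ≫ γ₁`. -/

/-- The set of all elements (arrows) of a groupoid with unit space `X`. -/
abbrev Arrows (X : Type u) [Groupoid.{v} X] : Type (max u v) := Quiver.Total X

/-- The source map. -/
def src {X : Type u} [Groupoid.{v} X] (γ : Arrows X) : X := γ.left

/-- The range map. -/
def rng {X : Type u} [Groupoid.{v} X] (γ : Arrows X) : X := γ.right

/-- The unit at `x`, as an arrow. -/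
def unitArrow {X : Type u} [Groupoid.{v} X] (x : X) : Arrows X := ⟨x, x, 𝟙 x⟩

/-- Inversion of arrows. -/
def invArrow {X : Type u} [Groupoid.{v} X] (γ : Arrows X) : Arrows X :=
  ⟨γ.right, γ.left, Groupoid.inv γ.hom⟩

/-- The set of composable pairs `(γ₁, γ₂)`, that is, pairs with `s γ₁ = r γ₂`. -/
abbrev Composable (X : Type u) [Groupoid.{v} X] : Type (max u v) :=
  {p : Arrows X × Arrows X // src p.1 = rng p.2}

/-- The product `γ₁ γ₂` of a composable pair. -/
def mulArrow {X : Type u} [Groupoid.{v} X] (p : Composable X) : Arrows X :=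
  ⟨p.1.2.left, p.1.1.right, p.1.2.hom ≫ eqToHom p.2.symm ≫ p.1.1.hom⟩

/-- A Hausdorff étale groupoid whose unit space is a Cantor space. Continuity of `src` and of
`unitArrow` says that the topology of `X` is the one inherited from the space of arrows. -/
class CantorGroupoid (X : Type u) [Groupoid.{v} X] [TopologicalSpace X]
    [TopologicalSpace (Arrows X)] : Prop where
  t2_arrows : T2Space (Arrows X)
  continuous_unit : Continuous (unitArrow : X → Arrows X)
  continuous_inv : Continuous (invArrow : Arrows X → Arrows X)
  continuous_mul : Continuous (mulArrow : Composable X → Arrows X)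
  etale_src : IsLocalHomeomorph (src : Arrows X → X)
  etale_rng : IsLocalHomeomorph (rng : Arrows X → X)
  cantor : Nonempty (X ≃ₜ (ℕ → Bool))

section Groupoids

variable (X : Type u) [Groupoid.{v} X] [TopologicalSpace X] [TopologicalSpace (Arrows X)]

variable {X} in
/-- A compact open bisection: a compact open set of arrows on which source and range restrict to
homeomorphisms onto open subsets of the unit space. -/
structure IsCompactOpenBisection (B : Set (Arrows X)) : Prop where
  isCompact : IsCompact B
  isOpen : IsOpen B
  src_restrict : IsOpenEmbedding (B.domRestrict src)
  rng_restrict : IsOpenEmbedding (B.domRestrict rng)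

/-- Effectiveness: a compact open bisection through a nontrivial isotropy element contains an
element whose source and range are different. -/
def IsEffectiveGroupoid : Prop :=
  ∀ (x : X) (γ : x ⟶ x), γ ≠ 𝟙 x → ∀ B : Set (Arrows X), IsCompactOpenBisection B →
    (⟨x, x, γ⟩ : Arrows X) ∈ B → ∃ γ' ∈ B, src γ' ≠ rng γ'

/-- Minimality: all orbits are dense in the unit space. -/
def IsMinimalGroupoid : Prop :=
  ∀ x : X, Dense {y : X | ∃ γ : Arrows X, src γ = x ∧ rng γ = y}

/-- Pure infiniteness: every compact open set of units is the source of two compact open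
bisections with disjoint ranges inside that set. -/
def IsPurelyInfiniteGroupoid : Prop :=
  ∀ K : Set X, IsCompact K → IsOpen K → ∃ B B' : Set (Arrows X),
    IsCompactOpenBisection B ∧ IsCompactOpenBisection B' ∧ src '' B = K ∧ src '' B' = K ∧
      Disjoint (rng '' B) (rng '' B') ∧ rng '' B ⊆ K ∧ rng '' B' ⊆ K

variable {X} in
/-- The homeomorphism `g` of the unit space is induced by the full compact open bisection `B`. -/
def IsInducedBy (g : X ≃ₜ X) (B : Set (Arrows X)) : Prop :=
  IsCompactOpenBisection B ∧ src '' B = Set.univ ∧ rng '' B = Set.univ ∧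
    ∀ γ ∈ B, g (src γ) = rng γ

variable {X} in
/-- Full compact open bisections are the images of continuous sections of the source map. -/
theorem exists_isInducedBy_iff [CantorGroupoid X] (g : X ≃ₜ X) :
    (∃ B, IsInducedBy g B) ↔
      ∃ σ : X → Arrows X, Continuous σ ∧ ∀ x, src (σ x) = x ∧ rng (σ x) = g x := by
  constructor
  · rintro ⟨B, hB, hs, -, hg⟩
    have hbij : Function.Bijective (B.domRestrict src) := by
      refine ⟨hB.src_restrict.injective, fun x => ?_⟩
      obtain ⟨γ, hγ, rfl⟩ : x ∈ src '' B := hs ▸ Set.mem_univ x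
      exact ⟨⟨γ, hγ⟩, rfl⟩
    let e := (Equiv.ofBijective _ hbij).toHomeomorphOfContinuousOpen
      hB.src_restrict.continuous hB.src_restrict.isOpenMap
    have he : ∀ x, src (e.symm x : Arrows X) = x := fun x => e.apply_symm_apply x
    refine ⟨fun x => (e.symm x : Arrows X), continuous_subtype_val.comp e.symm.continuous,
      fun x => ⟨he x, ?_⟩⟩
    rw [← hg _ (e.symm x).2, he]
  · rintro ⟨σ, hσ, h⟩
    obtain ⟨c⟩ := CantorGroupoid.cantor (X := X)
    have : CompactSpace X := c.symm.compactSpace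
    have hss : src ∘ σ = id := funext fun x => (h x).1
    have hrs : rng ∘ σ = g := funext fun x => (h x).2
    have hopen : IsOpenEmbedding σ :=
      CantorGroupoid.etale_src.isOpenEmbedding_of_comp (hss ▸ IsOpenEmbedding.id) hσ
    have hB : IsOpen (Set.range σ) := hopen.isOpen_range
    refine ⟨Set.range σ, ⟨isCompact_range hσ, hB, ?_, ?_⟩, ?_, ?_, ?_⟩
    · refine IsLocalHomeomorph.isOpenEmbedding_of_injective
        (CantorGroupoid.etale_src.comp hB.isOpenEmbedding_subtypeVal.isLocalHomeomorph) ?_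
      rintro ⟨_, x, rfl⟩ ⟨_, y, rfl⟩ hxy
      have hxy' : src (σ x) = src (σ y) := hxy
      rw [(h x).1, (h y).1] at hxy'
      subst hxy'; rfl
    · refine IsLocalHomeomorph.isOpenEmbedding_of_injective
        (CantorGroupoid.etale_rng.comp hB.isOpenEmbedding_subtypeVal.isLocalHomeomorph) ?_
      rintro ⟨_, x, rfl⟩ ⟨_, y, rfl⟩ hxy
      have hxy' : rng (σ x) = rng (σ y) := hxy
      rw [(h x).2, (h y).2] at hxy'
      obtain rfl := g.injective hxy'; rfl
    · rw [← Set.range_comp, hss, Set.range_id]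
    · rw [← Set.range_comp, hrs, g.surjective.range_eq]
    · rintro _ ⟨x, rfl⟩
      rw [(h x).1, (h x).2]

/-- The topological full group: the group of homeomorphisms of the unit space that are induced by
compact open bisections `B` with `s(B) = r(B) = X`. -/
def topologicalFullGroup [CantorGroupoid X] : Subgroup (X ≃ₜ X) where
  carrier := {g | ∃ B, IsInducedBy g B}
  one_mem' := by
    rw [Set.mem_ofPred_eq, exists_isInducedBy_iff]
    exact ⟨unitArrow, CantorGroupoid.continuous_unit, fun x => ⟨rfl, rfl⟩⟩
  mul_mem' := by
    intro g h hg hh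
    rw [Set.mem_ofPred_eq, exists_isInducedBy_iff] at hg hh ⊢
    obtain ⟨σ, hσ, hσ'⟩ := hg
    obtain ⟨τ, hτ, hτ'⟩ := hh
    refine ⟨fun x => mulArrow ⟨(σ (h x), τ x), ((hσ' _).1.trans (hτ' x).2.symm)⟩,
      CantorGroupoid.continuous_mul.comp
        (((hσ.comp h.continuous).prodMk hτ).subtype_mk _), fun x => ⟨(hτ' x).1, (hσ' _).2⟩⟩
  inv_mem' := by
    intro g hg
    rw [Set.mem_ofPred_eq, exists_isInducedBy_iff] at hg ⊢
    obtain ⟨σ, hσ, hσ'⟩ := hg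
    refine ⟨fun x => invArrow (σ (g⁻¹ x)),
      CantorGroupoid.continuous_inv.comp (hσ.comp (g⁻¹).continuous),
      fun x => ⟨(hσ' _).2.trans (g.apply_symm_apply x), (hσ' _).1⟩⟩

end Groupoids

/-! ## Characters of a group -/

section Characters

variable {Γ : Type u} [Group Γ]

/-- A character: a normalised, conjugation invariant function of positive type. -/
structure IsCharacter (χ : Γ → ℂ) : Prop where
  map_mul_comm : ∀ g h, χ (g * h) = χ (h * g)
  map_one : χ 1 = 1
  posSemidef : ∀ (n : ℕ) (g : Fin n → Γ),
    (Matrix.of fun i j => χ (g i * (g j)⁻¹)).PosSemidef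

/-- A character is decomposable if it is a proper convex combination of two different characters. -/
def IsDecomposable (χ : Γ → ℂ) : Prop :=
  ∃ (χ₁ χ₂ : Γ → ℂ) (t : ℝ), IsCharacter χ₁ ∧ IsCharacter χ₂ ∧ χ₁ ≠ χ₂ ∧ 0 < t ∧ t < 1 ∧
    ∀ g, χ g = (t : ℂ) * χ₁ g + (1 - (t : ℂ)) * χ₂ g

/-- An indecomposable character. -/
def IsIndecomposableCharacter (χ : Γ → ℂ) : Prop :=
  IsCharacter χ ∧ ¬ IsDecomposable χ

open Classical in
/-- The regular character. -/
noncomputable def regularCharacter (Γ : Type u) [Group Γ] : Γ → ℂ := fun g => if g = 1 then 1 else 0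

end Characters

/-! ## Finite factor representations -/

section Representations

variable {Γ : Type u} [Group Γ]
variable {H : Type w} [NormedAddCommGroup H] [InnerProductSpace ℂ H] [CompleteSpace H]

/-- The set of operators `π(Γ)`. -/
def repOperators (π : Γ →* unitary (H →L[ℂ] H)) : Set (H →L[ℂ] H) :=
  Set.range fun g => (π g : H →L[ℂ] H)

theorem star_repOperators (π : Γ →* unitary (H →L[ℂ] H)) :
    star (repOperators π) = repOperators π := by
  have h : ∀ g, star (π g : H →L[ℂ] H) = (π g⁻¹ : H →L[ℂ] H) := fun g => by
    rw [map_inv, ← Unitary.star_eq_inv, Unitary.coe_star]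
  ext a
  constructor
  · rintro ⟨g, hg⟩
    exact ⟨g⁻¹, by simp only at hg ⊢; rw [← h, hg, star_star]⟩
  · rintro ⟨g, rfl⟩
    exact ⟨g⁻¹, by simp only; rw [← h]⟩

/-- The von Neumann algebra `π(Γ)''` generated by a unitary representation `π`. -/
noncomputable def repVonNeumannAlgebra (π : Γ →* unitary (H →L[ℂ] H)) : VonNeumannAlgebra H where
  toSubalgebra := Subalgebra.centralizer ℂ (Set.centralizer (repOperators π))
  star_mem' := by
    intro a ha b hb
    have hb' : star b ∈ Set.centralizer (repOperators π) := by
      intro c hc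
      have hc' : star c ∈ repOperators π := by
        rw [← star_repOperators π]; simpa using hc
      have := congrArg star (hb (star c) hc')
      simpa using this.symm
    have := congrArg star (ha (star b) hb')
    simpa using this.symm
  centralizer_centralizer' := by
    change Set.centralizer (Set.centralizer (Set.centralizer (Set.centralizer _)))
      = Set.centralizer (Set.centralizer _)
    rw [Set.centralizer_centralizer_centralizer]

theorem rep_mem (π : Γ →* unitary (H →L[ℂ] H)) (g : Γ) :
    (π g : H →L[ℂ] H) ∈ (repVonNeumannAlgebra π).toStarSubalgebra :=
  Set.subset_centralizer_centralizer (Set.mem_range_self g)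

/-- The operator `π(g)` as an element of `π(Γ)''`. -/
noncomputable def repElement (π : Γ →* unitary (H →L[ℂ] H)) (g : Γ) :
    (repVonNeumannAlgebra π).toStarSubalgebra :=
  ⟨(π g : H →L[ℂ] H), rep_mem π g⟩

/-- A von Neumann algebra `M` is a factor if `M ∩ M' = ℂ id`. -/
def IsVNFactor (M : VonNeumannAlgebra H) : Prop :=
  (M : Set (H →L[ℂ] H)) ∩ (M.commutant : Set (H →L[ℂ] H)) =
    Set.range fun c : ℂ => c • (1 : H →L[ℂ] H)

/-- A faithful normal tracial state. Normality is expressed by writing the functional as a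
countable sum of vector functionals `a ↦ ⟪ξ n, a (ξ n)⟫` with `∑ ‖ξ n‖ ^ 2 < ∞`, that is, by a
positive trace class density operator. -/
structure IsFaithfulNormalTracialState (M : VonNeumannAlgebra H)
    (τ : M.toStarSubalgebra →ₗ[ℂ] ℂ) : Prop where
  map_one : τ 1 = 1
  nonneg : ∀ a, 0 ≤ τ (star a * a)
  tracial : ∀ a b, τ (a * b) = τ (b * a)
  faithful : ∀ a, τ (star a * a) = 0 → a = 0
  normal : ∃ ξ : ℕ → H, Summable (fun n => ‖ξ n‖ ^ 2) ∧
    ∀ a : M.toStarSubalgebra, HasSum (fun n => ⟪ξ n, (a : H →L[ℂ] H) (ξ n)⟫_ℂ) (τ a)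

/-- A finite factor representation: `π(Γ)''` is a finite factor, that is, a factor with a faithful
normal tracial state. -/
def IsFiniteFactorRep (π : Γ →* unitary (H →L[ℂ] H)) : Prop :=
  IsVNFactor (repVonNeumannAlgebra π) ∧
    ∃ τ, IsFaithfulNormalTracialState (repVonNeumannAlgebra π) τ

/-- A finite factor representation is regular if its character `g ↦ τ (π g)`, where `τ` is the
trace of the finite factor `π(Γ)''`, is the regular character. -/
def HasRegularCharacter (π : Γ →* unitary (H →L[ℂ] H)) : Prop :=
  ∀ τ, IsFaithfulNormalTracialState (repVonNeumannAlgebra π) τ →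
    ∀ g, τ (repElement π g) = regularCharacter Γ g

end Representations

/-! ## Characters as Gram kernels -/

section CharacterTheory

open Filter

variable {Γ : Type u} [Group Γ] {χ : Γ → ℂ}

/-! Both statements reduce to a dichotomy for factorial characters: each is regular or has absolute
value one everywhere. In the second case, equality in Cauchy-Schwarz makes χ multiplicative, so it
factors through the abelianization.

The common input from indecomposability and from the factor property is `IsFactorial`. Suppose
averages of group elements asymptotically commute, in the 2-norm, with generators. In a finite
factor their weak limit T is central, hence scalar, so τ(T π(h)) = τ(T) τ(π(h)). For an
indecomposable character the limits L(g) of χ(average · g) play the role of T: χ ± Re(cL), suitably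
understood, are positive multiples of characters, so indecomposability forces L to be a multiple of
χ.

The dynamics enter through `IsSwapRich`. If b and h have disjoint supports that leave a point x
uncovered, copies of b can be shrunk towards x by conjugators commuting with h. Averages of many
disjoint copies asymptotically commute with every g that moves x, since off-diagonal terms cancel,
and such g generate. Hence χ(bh) = χ(b)χ(h) (`IsFactorial.map_mul_of_disjoint`).

Now let χ(g) ≠ 0 with g ≠ 1. Conjugates of g by disjoint copies of b inside a set displaced by g⁻¹
have Gram entries |χ(b)|⁴, and Cauchy-Schwarz gives |χ(g)|² ≤ |χ(b)|⁴ for every b with proper clopen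
support. But products of disjoint copies of b keep proper support while |χ| is squared repeatedly,
so |χ(b)| = 1. Every nontrivial element is a product of two elements with proper support, which
finishes the dichotomy.

For the full group, swaps come from gluing bisections. Minimality moves small clopen sets into Z,
and pure infiniteness makes room in Z to assemble these pieces injectively. -/

theorem IsCharacter.map_conj (hχ : IsCharacter χ) (k g : Γ) : χ (k * g * k⁻¹) = χ g := by
  rw [hχ.map_mul_comm, inv_mul_cancel_left]

theorem IsCharacter.map_inv (hχ : IsCharacter χ) (g : Γ) : χ g⁻¹ = star (χ g) := by
  have h := (hχ.posSemidef 2 ![g, 1]).isHermitian.apply 0 1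
  simpa using congrArg star h

theorem IsCharacter.sum_nonneg (hχ : IsCharacter χ) (x : Γ →₀ ℂ) :
    0 ≤ x.sum fun g a => x.sum fun h b => star a * χ (g * h⁻¹) * b := by
  classical
  let e := x.support.equivFin
  let f : Fin x.support.card ↪ Γ := e.symm.toEmbedding.trans (Function.Embedding.subtype _)
  have hx : (x.comapDomain f f.injective.injOn).embDomain f = x := by
    apply Finsupp.embDomain_comapDomain
    intro g hg
    exact ⟨e ⟨g, hg⟩, by simp [f]⟩
  have := (hχ.posSemidef _ f).2 (x.comapDomain f f.injective.injOn)
  rw [← hx]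
  simpa only [Finsupp.sum_embDomain, Matrix.of_apply] using this

/-- Every character is the Gram kernel of a family of vectors. -/
theorem IsCharacter.exists_inner (hχ : IsCharacter χ) :
    ∃ (E : Type u) (_ : SeminormedAddCommGroup E) (_ : InnerProductSpace ℂ E) (ξ : Γ → E),
      ∀ g h, ⟪ξ g, ξ h⟫_ℂ = χ (g⁻¹ * h) := by
  let core : PreInnerProductSpace.Core ℂ (Γ →₀ ℂ) :=
    { inner x y := x.sum fun g a => y.sum fun h b => star a * χ (g * h⁻¹) * b
      conj_inner_symm x y := by
        simp only [Finsupp.sum, map_sum, map_mul]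
        rw [Finset.sum_comm]
        refine Finset.sum_congr rfl fun g _ => Finset.sum_congr rfl fun h _ => ?_
        have : (starRingEnd ℂ) (χ (h * g⁻¹)) = χ (g * h⁻¹) := by
          rw [starRingEnd_apply, ← hχ.map_inv]; simp
        simp only [this, starRingEnd_apply, star_star]
        ring
      re_inner_nonneg x := (RCLike.nonneg_iff.mp (hχ.sum_nonneg x)).1
      add_left x y z := by
        classical
        rw [Finsupp.sum_add_index']
        · simp
        · intro g a b
          simp [add_mul]
      smul_left x y r := by
        rw [Finsupp.sum_smul_index' (by simp), Finsupp.mul_sum]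
        refine Finset.sum_congr rfl fun g _ => ?_
        simp only [Finsupp.mul_sum]
        refine Finset.sum_congr rfl fun h _ => ?_
        simp
        ring }
  let s := @InnerProductSpace.Core.toSeminormedAddCommGroup ℂ _ _ _ _ core
  let i : InnerProductSpace ℂ (Γ →₀ ℂ) := InnerProductSpace.ofCore core
  -- The form uses the kernel χ(g h⁻¹), so g is sent to the point mass at g⁻¹. The form may be
  -- degenerate; a seminorm suffices for Cauchy-Schwarz.
  refine ⟨Γ →₀ ℂ, s, i, fun g => Finsupp.single g⁻¹ 1, fun g h => ?_⟩
  change (Finsupp.single g⁻¹ (1 : ℂ)).sum (fun g a => (Finsupp.single h⁻¹ (1 : ℂ)).sum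
    fun h b => star a * χ (g * h⁻¹) * b) = _
  simp

section Gram

variable {E : Type w} [SeminormedAddCommGroup E] [InnerProductSpace ℂ E] {ξ : Γ → E}

theorem posSemidef_of_inner (hξ : ∀ g h, ⟪ξ g, ξ h⟫_ℂ = χ (g⁻¹ * h)) (n : ℕ) (g : Fin n → Γ) :
    (Matrix.of fun i j => χ (g i * (g j)⁻¹)).PosSemidef := by
  have : (Matrix.of fun i j => χ (g i * (g j)⁻¹)) = Matrix.gram ℂ fun i => ξ (g i)⁻¹ := by
    ext i j
    simp [Matrix.gram, hξ]
  rw [this]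
  exact Matrix.posSemidef_gram _ _

theorem IsCharacter.norm_gram (hχ : IsCharacter χ) (hξ : ∀ g h, ⟪ξ g, ξ h⟫_ℂ = χ (g⁻¹ * h))
    (g : Γ) : ‖ξ g‖ = 1 := by
  have h := inner_self_eq_norm_sq (𝕜 := ℂ) (ξ g)
  rw [hξ, inv_mul_cancel, hχ.map_one, RCLike.one_re] at h
  nlinarith [norm_nonneg (ξ g)]

/-- Left translation preserves the kernel χ(g⁻¹h), hence acts isometrically on the span of the
vectors. -/
theorem norm_sum_smul_mul_left (hξ : ∀ g h, ⟪ξ g, ξ h⟫_ℂ = χ (g⁻¹ * h)) {ι : Type*}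
    (t : Finset ι) (x : ι → ℂ) (g : ι → Γ) (a : Γ) :
    ‖∑ i ∈ t, x i • ξ (a * g i)‖ = ‖∑ i ∈ t, x i • ξ (g i)‖ := by
  rw [@norm_eq_sqrt_re_inner ℂ, @norm_eq_sqrt_re_inner ℂ]
  simp only [sum_inner, inner_sum, inner_smul_left, inner_smul_right, hξ]
  simp [mul_assoc]

/-- This is the squared 2-norm of the commutator of ∑ s i with g; it explains the double sum in
`IsFactorial`. -/
theorem IsCharacter.norm_sum_sub_sq (hχ : IsCharacter χ)
    (hξ : ∀ g h, ⟪ξ g, ξ h⟫_ℂ = χ (g⁻¹ * h)) {ι : Type*} (t : Finset ι) (s : ι → Γ) (g : Γ) :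
    ‖∑ i ∈ t, ξ (s i * g) - ∑ i ∈ t, ξ (g * s i)‖ ^ 2 =
      2 * (∑ i ∈ t, ∑ j ∈ t, (χ ((s i)⁻¹ * s j) - χ (g⁻¹ * (s i)⁻¹ * g * s j))).re := by
  rw [@norm_sub_sq ℂ, ← @inner_self_eq_norm_sq ℂ, ← @inner_self_eq_norm_sq ℂ]
  simp only [sum_inner, inner_sum, hξ, Finset.sum_sub_distrib]
  have h1 : ∀ i j, χ ((s i * g)⁻¹ * (s j * g)) = χ ((s i)⁻¹ * s j) := fun i j => by
    rw [← hχ.map_conj g⁻¹ ((s i)⁻¹ * s j)]; congr 1; group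
  have h2 : ∀ i j, χ ((g * s i)⁻¹ * (g * s j)) = χ ((s i)⁻¹ * s j) := fun i j => by
    congr 1; group
  have h3 : ∀ i j, χ ((s i * g)⁻¹ * (g * s j)) = χ (g⁻¹ * (s i)⁻¹ * g * s j) := fun i j => by
    congr 1; group
  simp only [h1, h2, h3, Complex.sub_re, RCLike.re_to_complex]
  rw [Finset.sum_comm (f := fun i j => χ ((s j)⁻¹ * s i)),
    Finset.sum_comm (f := fun i j => χ (g⁻¹ * (s j)⁻¹ * g * s i))]
  ring

end Gram

theorem IsCharacter.norm_le_one (hχ : IsCharacter χ) (g : Γ) : ‖χ g‖ ≤ 1 := by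
  obtain ⟨E, _, _, ξ, hξ⟩ := hχ.exists_inner
  have := norm_inner_le_norm (𝕜 := ℂ) (ξ 1) (ξ g)
  rwa [hξ, hχ.norm_gram hξ, hχ.norm_gram hξ, inv_one, one_mul, one_mul] at this

/-- A character is multiplicative at the elements where it has absolute value one. -/
theorem IsCharacter.map_mul_of_norm_eq_one (hχ : IsCharacter χ) {g : Γ} (hg : ‖χ g‖ = 1) (h : Γ) :
    χ (g * h) = χ g * χ h := by
  obtain ⟨E, _, _, ξ, hξ⟩ := hχ.exists_inner
  -- Equality case of Cauchy-Schwarz: ξ g⁻¹ is a multiple of ξ 1 up to a null vector.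
  have hn : ‖ξ g⁻¹ - star (χ g) • ξ 1‖ = 0 := by
    have h1 : ‖ξ g⁻¹ - star (χ g) • ξ 1‖ ^ 2 = 0 := by
      rw [@norm_sub_sq ℂ, inner_smul_right, hξ, norm_smul, hχ.norm_gram hξ, hχ.norm_gram hξ,
        norm_star, hg, inv_inv, mul_one, ← starRingEnd_apply, Complex.conj_mul', hg]
      norm_num
    simpa using h1
  have h2 := norm_inner_le_norm (𝕜 := ℂ) (ξ g⁻¹ - star (χ g) • ξ 1) (ξ h)
  rw [hn, zero_mul, inner_sub_left, inner_smul_left, hξ, hξ] at h2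
  have h3 := norm_le_zero_iff.mp h2
  simpa [sub_eq_zero] using h3

/-- Characters of absolute value one are homomorphisms to the circle. -/
theorem IsCharacter.exists_monoidHom (hχ : IsCharacter χ) (h1 : ∀ g, ‖χ g‖ = 1) :
    ∃ ρ : Abelianization Γ →* Circle, ∀ g, χ g = (ρ (Abelianization.of g) : ℂ) := by
  let f : Γ →* Circle :=
    { toFun g := ⟨χ g, mem_sphere_zero_iff_norm.mpr (h1 g)⟩
      map_one' := Circle.ext hχ.map_one
      map_mul' g h := Circle.ext (hχ.map_mul_of_norm_eq_one (h1 g) h) }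
  exact ⟨Abelianization.lift f, fun g => by rw [Abelianization.lift_apply_of]; rfl⟩

/-- Averages of group elements that asymptotically commute with a set of generators and on which
the character takes constant values act as scalars. -/
def IsFactorial (χ : Γ → ℂ) : Prop :=
  ∀ (S : Set Γ) (s : (N : ℕ) → Fin (N + 1) → Γ) (h : Γ) (p q : ℂ), Subgroup.closure S = ⊤ →
    (∀ g ∈ S, Tendsto (fun N : ℕ => (∑ i, ∑ j, (χ ((s N i)⁻¹ * s N j) -
      χ (g⁻¹ * (s N i)⁻¹ * g * s N j))).re / ((N : ℝ) + 1) ^ 2) atTop (𝓝 0)) →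
    (∀ N i, χ (s N i * h) = p) → (∀ N i, χ (s N i) = q) → p = q * χ h

end CharacterTheory

/-! ### Indecomposable characters are factorial -/

section Indecomposable

open Filter

theorem exists_tendsto_ultrafilter {α : Type*} (U : Ultrafilter α) {f : α → ℂ} {C : ℝ}
    (hf : ∀ a, ‖f a‖ ≤ C) : ∃ L, Tendsto f U (𝓝 L) := by
  obtain ⟨L, -, hL⟩ := (isCompact_closedBall (0 : ℂ) C).ultrafilter_le_nhds (U.map f)
    (by
      rw [Ultrafilter.coe_map, le_principal_iff, mem_map]
      exact Filter.univ_mem' fun a => by simpa using hf a)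
  exact ⟨L, hL⟩

variable {Γ : Type u} [Group Γ] {χ : Γ → ℂ}

theorem IsCharacter.norm_sum_div_le (hχ : IsCharacter χ) {N : ℕ} (s : Fin (N + 1) → Γ) :
    ‖(∑ i, χ (s i)) / ((N : ℂ) + 1)‖ ≤ 1 := by
  have hN : ‖(N : ℂ) + 1‖ = (N : ℝ) + 1 := by
    rw [← Nat.cast_succ, Complex.norm_natCast, Nat.cast_succ]
  rw [norm_div, hN, div_le_one (by positivity)]
  refine (norm_sum_le_of_le _ fun i _ => hχ.norm_le_one (s i)).trans (by simp)

/-- Cauchy-Schwarz estimate for the commutators of averages. -/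
theorem IsCharacter.tendsto_average_comm (hχ : IsCharacter χ) {s : (N : ℕ) → Fin (N + 1) → Γ}
    {g : Γ} (hs : Tendsto (fun N : ℕ => (∑ i, ∑ j, (χ ((s N i)⁻¹ * s N j) -
      χ (g⁻¹ * (s N i)⁻¹ * g * s N j))).re / ((N : ℝ) + 1) ^ 2) atTop (𝓝 0)) (h : Γ) :
    Tendsto (fun N : ℕ => (∑ i, χ (s N i * (g * h))) / ((N : ℂ) + 1) -
      (∑ i, χ (s N i * (h * g))) / ((N : ℂ) + 1)) atTop (𝓝 0) := by
  obtain ⟨E, _, _, ξ, hξ⟩ := hχ.exists_inner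
  have h0 : Tendsto (fun N : ℕ => √(2 * ((∑ i, ∑ j, (χ ((s N i)⁻¹ * s N j) -
      χ (g⁻¹ * (s N i)⁻¹ * g * s N j))).re / ((N : ℝ) + 1) ^ 2))) atTop (𝓝 0) := by
    simpa using (hs.const_mul 2).sqrt
  refine squeeze_zero_norm (fun N => ?_) h0
  have hN : ‖(N : ℂ) + 1‖ = (N : ℝ) + 1 := by
    rw [← Nat.cast_succ, Complex.norm_natCast, Nat.cast_succ]
  have e : ∑ i, χ (s N i * (g * h)) - ∑ i, χ (s N i * (h * g)) =
      ⟪ξ h⁻¹, ∑ i, ξ (s N i * g) - ∑ i, ξ (g * s N i)⟫_ℂ := by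
    simp only [inner_sub_right, inner_sum, hξ, inv_inv]
    congr 1 <;> refine Finset.sum_congr rfl fun i _ => ?_
    · rw [hχ.map_mul_comm h, mul_assoc]
    · rw [hχ.map_mul_comm (s N i), mul_assoc]
  rw [← sub_div, norm_div, hN, e, ← mul_div_assoc, ← hχ.norm_sum_sub_sq hξ, ← div_pow,
    Real.sqrt_sq (by positivity)]
  gcongr
  refine (norm_inner_le_norm _ _).trans ?_
  rw [hχ.norm_gram hξ, one_mul]

/-- A central perturbation of a character, normalised, is a character. -/
theorem IsCharacter.perturb (hχ : IsCharacter χ) {s : (N : ℕ) → Fin (N + 1) → Γ}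
    {U : Ultrafilter ℕ} {L : Γ → ℂ}
    (hL : ∀ g, Tendsto (fun N : ℕ => (∑ i, χ (s N i * g)) / ((N : ℂ) + 1)) U (𝓝 (L g)))
    (hcomm : ∀ g h, L (g * h) = L (h * g)) {c : ℂ} (hc : ‖c‖ ≤ 1)
    (hpos : 0 < 1 + (c * L 1).re) :
    IsCharacter fun g => (χ g + (c * L g + star c * star (L g⁻¹)) / 2) /
      ((1 + (c * L 1).re : ℝ) : ℂ) := by
  obtain ⟨E, _, _, ξ, hξ⟩ := hχ.exists_inner
  have hre : ∀ z : ℂ, (z + star z) / 2 = (z.re : ℂ) := fun z => by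
    rw [← starRingEnd_apply, Complex.add_conj]; push_cast; ring
  refine ⟨fun g h => ?_, ?_, fun n g => ?_⟩
  · simp only [hχ.map_mul_comm g h, hcomm g h, mul_inv_rev, hcomm h⁻¹ g⁻¹]
  · have : (χ 1 + (c * L 1 + star c * star (L 1⁻¹)) / 2) = ((1 + (c * L 1).re : ℝ) : ℂ) := by
      rw [inv_one, ← star_mul', hre, hχ.map_one]; push_cast; ring
    simp only [this]
    exact div_self (by exact_mod_cast hpos.ne')
  · refine ⟨?_, fun x => ?_⟩
    · ext i j
      simp only [Matrix.conjTranspose_apply, Matrix.of_apply, star_div₀, star_add, star_mul',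
        ← hχ.map_inv, mul_inv_rev, inv_inv, star_star]
      simp only [← starRingEnd_apply, Complex.conj_ofReal, map_ofNat]
      ring
    · let y := ∑ i, star (x i) • ξ (g i)
      have hZ : Tendsto (fun N : ℕ => ∑ i, ∑ j, star (x i) *
          ((∑ k, χ (s N k * (g i * (g j)⁻¹))) / ((N : ℂ) + 1)) * x j) U
          (𝓝 (∑ i, ∑ j, star (x i) * L (g i * (g j)⁻¹) * x j)) :=
        tendsto_finsetSum _ fun i _ => tendsto_finsetSum _ fun j _ =>
          ((hL _).const_mul _).mul_const _
      -- Each s N k acts isometrically, so their average is a contraction, and its matrix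
      -- coefficient at y is at most ‖y‖². This lets the form of χ absorb the perturbation when ‖c‖
      -- ≤ 1.
      have hN : ∀ N : ℕ, ‖∑ i, ∑ j, star (x i) *
          ((∑ k, χ (s N k * (g i * (g j)⁻¹))) / ((N : ℂ) + 1)) * x j‖ ≤ ‖y‖ ^ 2 := fun N => by
        have hN1 : ‖(N : ℂ) + 1‖ = (N : ℝ) + 1 := by
          rw [← Nat.cast_succ, Complex.norm_natCast, Nat.cast_succ]
        have e : ∑ i, ∑ j, star (x i) *
            ((∑ k, χ (s N k * (g i * (g j)⁻¹))) / ((N : ℂ) + 1)) * x j =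
            (∑ k, ⟪y, ∑ i, star (x i) • ξ (s N k * g i)⟫_ℂ) / ((N : ℂ) + 1) := by
          simp only [y, sum_inner, inner_sum, inner_smul_left, inner_smul_right, hξ,
            Finset.sum_div, Finset.mul_sum, Finset.sum_mul]
          rw [Finset.sum_comm]
          conv_lhs => enter [2, j]; rw [Finset.sum_comm]
          rw [Finset.sum_comm]
          refine Finset.sum_congr rfl fun k _ => ?_
          rw [Finset.sum_comm]
          refine Finset.sum_congr rfl fun i _ => Finset.sum_congr rfl fun j _ => ?_
          rw [← mul_assoc (s N k), hχ.map_mul_comm _ (g j)⁻¹, starRingEnd_apply, star_star]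
          ring
        rw [e, norm_div, hN1, div_le_iff₀ (by positivity)]
        refine (norm_sum_le_of_le (f := fun k => ⟪y, ∑ i, star (x i) • ξ (s N k * g i)⟫_ℂ)
          (n := fun _ => ‖y‖ ^ 2) _ fun k _ => ?_).trans ?_
        · refine (norm_inner_le_norm _ _).trans ?_
          rw [norm_sum_smul_mul_left hξ, sq]
        · simp [mul_comm]
      have hZle := le_of_tendsto hZ.norm (Eventually.of_forall hN)
      set Z := ∑ i, ∑ j, star (x i) * L (g i * (g j)⁻¹) * x j with hZdef
      have hW : ∑ i, ∑ j, star (x i) * χ (g i * (g j)⁻¹) * x j = ((‖y‖ ^ 2 : ℝ) : ℂ) := by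
        rw [Complex.ofReal_pow]
        refine Eq.trans ?_ (inner_self_eq_norm_sq_to_K (𝕜 := ℂ) y)
        simp only [y, sum_inner, inner_sum, inner_smul_left, inner_smul_right, hξ, Finset.mul_sum]
        refine Finset.sum_congr rfl fun j _ => Finset.sum_congr rfl fun i _ => ?_
        rw [hχ.map_mul_comm, starRingEnd_apply, star_star]
        ring
      have hZ' : ∑ i, ∑ j, star (x i) * star (L (g i * (g j)⁻¹)⁻¹) * x j = star Z := by
        simp only [hZdef, star_sum, star_mul', star_star]
        rw [Finset.sum_comm]
        refine Finset.sum_congr rfl fun i _ => Finset.sum_congr rfl fun j _ => ?_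
        rw [mul_inv_rev, inv_inv]
        ring
      have e : x.sum (fun i xi => x.sum fun j xj => star xi * (Matrix.of fun i j =>
          (χ (g i * (g j)⁻¹) + (c * L (g i * (g j)⁻¹) + star c * star (L (g i * (g j)⁻¹)⁻¹)) / 2) /
          ((1 + (c * L 1).re : ℝ) : ℂ)) i j * xj) =
          (((‖y‖ ^ 2 + (c * Z).re) / (1 + (c * L 1).re) : ℝ) : ℂ) := by
        rw [Finsupp.sum_fintype _ _ (by simp)]
        simp only [Finsupp.sum_fintype, mul_zero, implies_true, Matrix.of_apply]
        rw [Complex.ofReal_div (‖y‖ ^ 2 + (c * Z).re), Complex.ofReal_add (‖y‖ ^ 2), ← hW, ← hre,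
          star_mul', ← hZ', hZdef]
        simp only [Finset.mul_sum, Finset.sum_div, ← Finset.sum_add_distrib]
        refine Finset.sum_congr rfl fun i _ => Finset.sum_congr rfl fun j _ => ?_
        ring
      rw [e]
      have h1 : ‖c * Z‖ ≤ ‖y‖ ^ 2 := by
        rw [norm_mul]; nlinarith [norm_nonneg Z, norm_nonneg c]
      have h2 := (abs_le.mp (Complex.abs_re_le_norm (c * Z))).1
      exact_mod_cast div_nonneg (by linarith) hpos.le

/-- The limit L of the averaged functionals is tracial, because the elements commuting with it form
a subgroup containing S. Perturbing χ by cL and by -cL writes χ as a convex combination of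
characters, which must coincide with χ. -/
theorem IsIndecomposableCharacter.isFactorial (hχ : IsIndecomposableCharacter χ) :
    IsFactorial χ := by
  intro S s h p q hS hs hp hq
  obtain ⟨hχ, hd⟩ := hχ
  let U : Ultrafilter ℕ := hyperfilter ℕ
  have hU : (U : Filter ℕ) ≤ atTop := Nat.hyperfilter_le_atTop
  choose L hL using fun g => exists_tendsto_ultrafilter U
    (fun N => hχ.norm_sum_div_le fun i => s N i * g)
  have hconst : ∀ g r, (∀ N i, χ (s N i * g) = r) → L g = r := fun g r hr => by
    refine tendsto_nhds_unique (hL g) (tendsto_const_nhds.congr fun N => ?_)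
    have : (N : ℂ) + 1 ≠ 0 := by exact_mod_cast N.succ_ne_zero
    simp [hr]
    field_simp
  have hL1 : L 1 = q := hconst 1 q (by simpa using hq)
  have hcomm : ∀ g h, L (g * h) = L (h * g) := by
    intro g
    have hg : g ∈ Subgroup.closure S := hS ▸ Subgroup.mem_top g
    induction hg using Subgroup.closure_induction with
    | mem g hg =>
      intro h
      refine sub_eq_zero.mp (tendsto_nhds_unique ((hL (g * h)).sub (hL (h * g))) ?_)
      exact (hχ.tendsto_average_comm (hs g hg) h).mono_left hU
    | one => simp
    | mul a b _ _ ha hb =>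
      intro h
      rw [mul_assoc, ha, mul_assoc, hb, mul_assoc]
    | inv a _ ha =>
      intro h
      have := ha (a⁻¹ * h * a⁻¹)
      simpa [mul_assoc] using this.symm
  have hq1 : ‖q‖ ≤ 1 := hq 0 0 ▸ hχ.norm_le_one _
  -- The bound 1/2 keeps both normalising factors positive and the weight (1 + Re(cq))/2 strictly
  -- between 0 and 1.
  have key : ∀ c : ℂ, ‖c‖ ≤ 1 / 2 → ∀ g,
      χ g + (c * L g + star c * star (L g⁻¹)) / 2 = ((1 + (c * q).re : ℝ) : ℂ) * χ g := by
    intro c hc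
    have hcq : ‖c * q‖ ≤ 1 / 2 := by
      rw [norm_mul]; nlinarith [norm_nonneg c, norm_nonneg q]
    have hcq' := abs_le.mp ((Complex.abs_re_le_norm (c * q)).trans hcq)
    have h1 : 0 < 1 + (c * L 1).re := by rw [hL1]; linarith
    have h2 : 0 < 1 + (-c * L 1).re := by rw [hL1, neg_mul, Complex.neg_re]; linarith
    have ne1 : ((1 + (c * q).re : ℝ) : ℂ) ≠ 0 := by rw [hL1] at h1; exact_mod_cast h1.ne'
    have ne2 : ((1 + (-c * q).re : ℝ) : ℂ) ≠ 0 := by rw [hL1] at h2; exact_mod_cast h2.ne'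
    have c1 := hχ.perturb hL hcomm (c := c) (by linarith) h1
    have c2 := hχ.perturb hL hcomm (c := -c) (by rw [norm_neg]; linarith) h2
    rw [hL1] at c1 c2 h1 h2
    have hsum : ∀ g, χ g = (((1 + (c * q).re) / 2 : ℝ) : ℂ) *
          ((χ g + (c * L g + star c * star (L g⁻¹)) / 2) / ((1 + (c * q).re : ℝ) : ℂ)) +
        (1 - (((1 + (c * q).re) / 2 : ℝ) : ℂ)) *
          ((χ g + (-c * L g + star (-c) * star (L g⁻¹)) / 2) / ((1 + (-c * q).re : ℝ) : ℂ)) := by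
      intro g
      have : (1 - (((1 + (c * q).re) / 2 : ℝ) : ℂ)) = ((1 + (-c * q).re : ℝ) : ℂ) / 2 := by
        rw [neg_mul, Complex.neg_re]; push_cast; ring
      rw [this, Complex.ofReal_div, star_neg]
      generalize ((1 + (-c * q).re : ℝ) : ℂ) = r₂ at ne2 ⊢
      generalize ((1 + (c * q).re : ℝ) : ℂ) = r₁ at ne1 ⊢
      push_cast
      field_simp
      ring
    by_contra hne
    refine hd ⟨_, _, (1 + (c * q).re) / 2, c1, c2, fun heq => hne fun g => ?_, by linarith,
      by linarith, hsum⟩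
    have h3 := hsum g
    rw [← congrFun heq g, ← add_mul, add_sub_cancel, one_mul] at h3
    conv_rhs => rw [h3]
    field_simp
  -- The values c = 1/2 and c = I/2 determine p + star (L h⁻¹) and p - star (L h⁻¹); adding
  -- eliminates the adjoint term.
  have k1 := key (1 / 2) (by norm_num) h
  have k2 := key (Complex.I / 2) (by norm_num) h
  rw [hconst h p hp] at k1 k2
  have hq' := Complex.re_add_im q
  simp only [star_div₀, star_one, star_ofNat, Complex.star_def, Complex.conj_I] at k1 k2
  have r1 : ((1 / 2 * q).re : ℂ) = (q.re : ℂ) / 2 := by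
    simp
    ring
  have r2 : ((Complex.I / 2 * q).re : ℂ) = -(q.im : ℂ) / 2 := by
    have : (Complex.I / 2 * q).re = -q.im / 2 := by
      simp [Complex.mul_re]; ring
    rw [this]; push_cast; ring
  rw [Complex.ofReal_add, Complex.ofReal_one, r1] at k1
  rw [Complex.ofReal_add, Complex.ofReal_one, r2] at k2
  rw [← hq']
  linear_combination 2 * k1 - 2 * Complex.I * k2 +
    (p / 2 - starRingEnd ℂ (L h⁻¹) / 2) * Complex.I_sq

end Indecomposable

/-! ## Groups of homeomorphisms that contain many swaps -/

section SwapRich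

open Filter MulAction
open scoped Pointwise

/-- An action with two closure properties. If `g` displaces a clopen set `U`, then some element
that is supported on `U ∪ g • U` agrees with `g` on `U`. Every clopen set `V` is mapped into every
nonempty clopen set `Z` disjoint from it by some element supported on `V ∪ Z`. -/
structure IsSwapRich (Γ : Type u) (X : Type v) [Group Γ] [TopologicalSpace X] [MulAction Γ X] :
    Prop where
  swap : ∀ (g : Γ) (U : Set X), IsClopen U → Disjoint U (g • U) →
    ∃ h ∈ fixingSubgroup Γ (U ∪ g • U)ᶜ, ∀ x ∈ U, h • x = g • x
  compress : ∀ V Z : Set X, IsClopen V → IsClopen Z → Z.Nonempty → Disjoint V Z →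
    ∃ k ∈ fixingSubgroup Γ (V ∪ Z)ᶜ, k • V ⊆ Z

/-! ### Supports, commutation and conjugation -/

section Supports

variable {Γ : Type u} {X : Type v} [Group Γ] [MulAction Γ X]

theorem fixingSubgroup_compl_mono {V W : Set X} (h : V ⊆ W) :
    fixingSubgroup Γ Vᶜ ≤ fixingSubgroup Γ Wᶜ :=
  fixingSubgroup_antitone Γ X (Set.compl_subset_compl.mpr h)

theorem smul_mem_of_mem_fixingSubgroup_compl {V : Set X} {b : Γ} (hb : b ∈ fixingSubgroup Γ Vᶜ)
    {x : X} (hx : x ∈ V) : b • x ∈ V := by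
  by_contra h
  have := (mem_fixingSubgroup_iff Γ).mp hb _ h
  exact h ((smul_left_cancel b this).symm ▸ hx)

theorem commute_of_disjoint_support [FaithfulSMul Γ X] {V W : Set X} (h : Disjoint V W) {b c : Γ}
    (hb : b ∈ fixingSubgroup Γ Vᶜ) (hc : c ∈ fixingSubgroup Γ Wᶜ) : b * c = c * b := by
  refine eq_of_smul_eq_smul (α := X) fun x => ?_
  have hb' := (mem_fixingSubgroup_iff Γ).mp hb
  have hc' := (mem_fixingSubgroup_iff Γ).mp hc
  rw [mul_smul, mul_smul]
  by_cases hV : x ∈ V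
  · rw [hc' x (h.notMem_of_mem_left hV),
      hc' _ (h.notMem_of_mem_left (smul_mem_of_mem_fixingSubgroup_compl hb hV))]
  · rw [hb' x hV]
    by_cases hW : x ∈ W
    · rw [hb' _ (h.notMem_of_mem_right (smul_mem_of_mem_fixingSubgroup_compl hc hW))]
    · rw [hc' x hW, hb' x hV]

theorem conj_mem_fixingSubgroup_compl {V : Set X} {b : Γ} (hb : b ∈ fixingSubgroup Γ Vᶜ) (k : Γ) :
    k * b * k⁻¹ ∈ fixingSubgroup Γ (k • V)ᶜ := by
  rw [mem_fixingSubgroup_iff] at hb ⊢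
  intro x hx
  rw [mul_smul, mul_smul, hb _ fun h => hx (Set.mem_smul_set_iff_inv_smul_mem.mpr h),
    smul_inv_smul]

/-- The element k⁻¹l fixes V pointwise, so it commutes with b. -/
theorem conj_eq_conj_of_eqOn [FaithfulSMul Γ X] {V : Set X} {b : Γ}
    (hb : b ∈ fixingSubgroup Γ Vᶜ) {k l : Γ} (h : ∀ x ∈ V, k • x = l • x) :
    k * b * k⁻¹ = l * b * l⁻¹ := by
  have hkl : k⁻¹ * l ∈ fixingSubgroup Γ Vᶜᶜ := by
    rw [compl_compl, mem_fixingSubgroup_iff]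
    intro x hx
    rw [mul_smul, ← h x hx, inv_smul_smul]
  have := commute_of_disjoint_support disjoint_compl_right hb hkl
  calc k * b * k⁻¹ = k * (b * (k⁻¹ * l)) * l⁻¹ := by group
    _ = l * b * l⁻¹ := by rw [this]; group

end Supports

variable {Γ : Type u} {X : Type v} [Group Γ] [TopologicalSpace X] [MulAction Γ X]
variable {χ : Γ → ℂ}

/-- Copies of `b` with different disjoint supports look the same from elsewhere. -/
theorem IsCharacter.map_mul_conj_eq [FaithfulSMul Γ X] [ContinuousConstSMul Γ X]
    (hΓ : IsSwapRich Γ X) (hχ : IsCharacter χ)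
    {V A : Set X} (hV : IsClopen V) {a b k l : Γ} (ha : a ∈ fixingSubgroup Γ Aᶜ)
    (hb : b ∈ fixingSubgroup Γ Vᶜ) (hk : Disjoint A (k • V)) (hl : Disjoint A (l • V))
    (hkl : Disjoint (k • V) (l • V)) : χ (a * (k * b * k⁻¹)) = χ (a * (l * b * l⁻¹)) := by
  have hkV : (l * k⁻¹) • k • V = l • V := by rw [smul_smul, inv_mul_cancel_right]
  -- The element h is supported on the two copies of V, so it commutes with a, and it conjugates one
  -- copy of b to the other.
  obtain ⟨h, hh, heq⟩ := hΓ.swap (l * k⁻¹) (k • V)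
    ⟨hV.1.smul k, hV.2.smul k⟩ (by rwa [hkV])
  rw [hkV] at hh
  have hcomm := commute_of_disjoint_support (Set.disjoint_union_right.mpr ⟨hk, hl⟩) ha hh
  have hconj : h * k * b * (h * k)⁻¹ = l * b * l⁻¹ := by
    refine conj_eq_conj_of_eqOn hb fun x hx => ?_
    rw [mul_smul, heq _ (Set.smul_mem_smul_set hx), mul_smul, inv_smul_smul]
  rw [← hconj, ← hχ.map_conj h]
  congr 1
  calc h * (a * (k * b * k⁻¹)) * h⁻¹ = (h * a) * (k * b * k⁻¹) * h⁻¹ := by group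
    _ = _ := by rw [← hcomm]; group

/-- Disjoint copies of an element inside a set that is displaced by `g` asymptotically commute
with `g`. -/
theorem IsCharacter.abs_sum_copies_le [FaithfulSMul Γ X] [ContinuousConstSMul Γ X]
    (hΓ : IsSwapRich Γ X) (hχ : IsCharacter χ) {V O : Set X}
    (hV : IsClopen V) {b g : Γ} (hb : b ∈ fixingSubgroup Γ Vᶜ) {ι : Type*} [Fintype ι] {k : ι → Γ}
    (hk : ∀ i, k i • V ⊆ O) (hd : Pairwise (Function.onFun Disjoint fun i => k i • V))
    (hg : Disjoint O (g⁻¹ • O)) :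
    |(∑ i, ∑ j, (χ ((k i * b * (k i)⁻¹)⁻¹ * (k j * b * (k j)⁻¹)) -
      χ (g⁻¹ * (k i * b * (k i)⁻¹)⁻¹ * g * (k j * b * (k j)⁻¹)))).re| ≤ 2 * Fintype.card ι := by
  classical
  -- For i ≠ j, conjugating the i-th copy by g⁻¹ only moves it to another place disjoint from the
  -- j-th, so the two terms agree. Only the diagonal survives, each entry at most 2 in norm.
  have h0 : ∀ i j, i ≠ j → χ ((k i * b * (k i)⁻¹)⁻¹ * (k j * b * (k j)⁻¹)) -
      χ (g⁻¹ * (k i * b * (k i)⁻¹)⁻¹ * g * (k j * b * (k j)⁻¹)) = 0 := by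
    intro i j hij
    have h1 : g⁻¹ • k i • V ⊆ g⁻¹ • O := Set.smul_set_mono (hk i)
    have h2 := hχ.map_mul_conj_eq hΓ hV (k := k i) (l := g⁻¹ * k i)
      (conj_mem_fixingSubgroup_compl hb (k j)) (inv_mem hb) (hd hij.symm)
      (by rw [mul_smul]; exact hg.mono (hk j) h1) (by rw [mul_smul]; exact hg.mono (hk i) h1)
    rw [sub_eq_zero, hχ.map_mul_comm, hχ.map_mul_comm (g⁻¹ * _ * g)]
    convert h2 using 2 <;> group
  refine (Complex.abs_re_le_norm _).trans ?_
  have h3 : ∀ i, ‖∑ j, (χ ((k i * b * (k i)⁻¹)⁻¹ * (k j * b * (k j)⁻¹)) -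
      χ (g⁻¹ * (k i * b * (k i)⁻¹)⁻¹ * g * (k j * b * (k j)⁻¹)))‖ ≤ 2 := fun i => by
    rw [Finset.sum_eq_single i (fun j _ hj => h0 i j hj.symm) (by simp)]
    refine (norm_sub_le _ _).trans ?_
    linarith [hχ.norm_le_one ((k i * b * (k i)⁻¹)⁻¹ * (k i * b * (k i)⁻¹)),
      hχ.norm_le_one (g⁻¹ * (k i * b * (k i)⁻¹)⁻¹ * g * (k i * b * (k i)⁻¹))]
  refine (norm_sum_le_of_le _ fun i _ => h3 i).trans ?_
  simp [mul_comm]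

/-! ### Compressing and displacing clopen sets; multiplicativity on disjoint supports -/

section Topological

variable [CompactSpace X] [T2Space X] [TotallyDisconnectedSpace X] [PerfectSpace X]

theorem exists_seq_isClopen_disjoint {O : Set X} (hO : IsOpen O) (hne : O.Nonempty) :
    ∃ Z : ℕ → Set X, (∀ n, IsClopen (Z n)) ∧ (∀ n, (Z n).Nonempty) ∧ (∀ n, Z n ⊆ O) ∧
      Pairwise (Function.onFun Disjoint Z) := by
  obtain ⟨x, hx⟩ := hne
  have : Infinite O := (infinite_of_mem_nhds x (hO.mem_nhds hx)).to_subtype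
  obtain ⟨U, hU, hUo, hUd⟩ := exists_seq_infinite_isOpen_pairwise_disjoint O
  have key : ∀ n, ∃ Z : Set X, IsClopen Z ∧ Z.Nonempty ∧ Z ⊆ (↑) '' U n := fun n => by
    obtain ⟨y, hy⟩ := (hU n).nonempty
    obtain ⟨Z, hZ, hyZ, hZU⟩ := compact_exists_isClopen_in_isOpen
      (hO.isOpenEmbedding_subtypeVal.isOpenMap _ (hUo n)) (Set.mem_image_of_mem _ hy)
    exact ⟨Z, hZ, ⟨_, hyZ⟩, hZU⟩
  choose Z hZ hZn hZU using key
  refine ⟨Z, hZ, hZn, fun n => (hZU n).trans (Subtype.coe_image_subset _ _), fun m n hmn => ?_⟩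
  exact ((Set.disjoint_image_iff Subtype.val_injective).mpr (hUd hmn)).mono (hZU m) (hZU n)

/-- Proper clopen sets are compressed into arbitrary nonempty open sets. -/
theorem IsSwapRich.exists_smul_subset [ContinuousConstSMul Γ X] (hΓ : IsSwapRich Γ X) {V O : Set X}
    (hV : IsClopen V) (hV1 : V ≠ Set.univ) (hO : IsOpen O) (hne : O.Nonempty) :
    ∃ k : Γ, k • V ⊆ O := by
  obtain ⟨z, hz⟩ := (Set.ne_univ_iff_exists_notMem V).mp hV1
  -- O may meet or lie inside V, so V is first moved into a small set Z off V near z, and then into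
  -- a set U near u that is disjoint from Z.
  obtain ⟨u, huO, huz⟩ : ∃ u ∈ O, u ≠ z := by
    obtain ⟨x, hx⟩ := hne
    exact (infinite_of_mem_nhds x (hO.mem_nhds hx)).exists_notMem_finite (Set.finite_singleton z)
  obtain ⟨P, Q, hP, hQ, huP, hzQ, hPQ⟩ := t2_separation huz
  obtain ⟨U, hU, huU, hUO⟩ := compact_exists_isClopen_in_isOpen (hO.inter hP) ⟨huO, huP⟩
  obtain ⟨Z, hZ, hzZ, hZQ⟩ := compact_exists_isClopen_in_isOpen
    (hV.compl.isOpen.inter hQ) ⟨hz, hzQ⟩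
  obtain ⟨k, -, hk⟩ := hΓ.compress V Z hV hZ ⟨z, hzZ⟩
    (Set.disjoint_left.mpr fun x hxV hxZ => (hZQ hxZ).1 hxV)
  obtain ⟨l, -, hl⟩ := hΓ.compress (k • V) U ⟨hV.1.smul k, hV.2.smul k⟩ hU ⟨u, huU⟩
    ((hPQ.symm.mono (hZQ.trans Set.inter_subset_right) (hUO.trans Set.inter_subset_right)).mono_left
      hk)
  exact ⟨l * k, by rw [mul_smul]; exact hl.trans (hUO.trans Set.inter_subset_left)⟩

theorem exists_isClopen_displaced [FaithfulSMul Γ X] [ContinuousConstSMul Γ X] {g : Γ}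
    (hg : g ≠ 1) : ∃ U : Set X, IsClopen U ∧ U.Nonempty ∧ Disjoint U (g • U) ∧
      U ∪ g • U ≠ Set.univ := by
  obtain ⟨x, hx⟩ : ∃ x : X, g • x ≠ x := by
    by_contra! h
    exact hg (eq_of_smul_eq_smul (α := X) fun x => by rw [h, one_smul])
  -- The third point y will stay outside U ∪ g • U, so that this union is proper.
  obtain ⟨y, -, hy⟩ := (infinite_of_mem_nhds x univ_mem).exists_notMem_finite
    (Set.toFinite {x, g • x})
  simp only [Set.mem_insert_iff, Set.mem_singleton_iff, not_or] at hy
  obtain ⟨P, Q, hP, hQ, hxP, hxQ, hPQ⟩ := t2_separation hx.symm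
  have hopen : IsOpen (P ∩ {y}ᶜ ∩ (g • ·) ⁻¹' (Q ∩ {y}ᶜ)) :=
    (hP.inter isOpen_compl_singleton).inter
      ((hQ.inter isOpen_compl_singleton).preimage (continuous_const_smul g))
  obtain ⟨U, hU, hxU, hUP⟩ := compact_exists_isClopen_in_isOpen hopen
    (Set.mem_inter (Set.mem_inter hxP (Ne.symm hy.1)) (Set.mem_inter hxQ (Ne.symm hy.2)))
  have hgU : g • U ⊆ Q ∩ {y}ᶜ := by
    rintro _ ⟨z, hz, rfl⟩
    exact (hUP hz).2
  refine ⟨U, hU, ⟨x, hxU⟩, hPQ.mono (fun z hz => (hUP hz).1.1) fun z hz => (hgU hz).1, ?_⟩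
  refine (Set.ne_univ_iff_exists_notMem _).mpr ⟨y, ?_⟩
  rintro (h | h)
  · exact (hUP h).1.2 rfl
  · exact (hgU h).2 rfl

variable [FaithfulSMul Γ X] [ContinuousConstSMul Γ X]

/-- Factorial characters are multiplicative on pairs of elements with disjoint supports that do
not fill the space. -/
theorem IsFactorial.map_mul_of_disjoint [FirstCountableTopology X] (hΓ : IsSwapRich Γ X)
    (hχ : IsCharacter χ) (hf : IsFactorial χ) {V W : Set X} (hV : IsClopen V) (hW : IsClopen W)
    (hVW : Disjoint V W) (hne : V ∪ W ≠ Set.univ) {b h : Γ} (hb : b ∈ fixingSubgroup Γ Vᶜ)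
    (hh : h ∈ fixingSubgroup Γ Wᶜ) : χ (b * h) = χ b * χ h := by
  obtain ⟨x, hx⟩ := (Set.ne_univ_iff_exists_notMem _).mp hne
  obtain ⟨B, hB⟩ := (𝓝 x).exists_antitone_basis
  have hO : ∀ N, ∃ Z : ℕ → Set X, (∀ n, IsClopen (Z n)) ∧ (∀ n, (Z n).Nonempty) ∧
      (∀ n, Z n ⊆ interior (B N) ∩ (V ∪ W)ᶜ) ∧ Pairwise (Function.onFun Disjoint Z) := fun N =>
    exists_seq_isClopen_disjoint (isOpen_interior.inter (hV.union hW).compl.isOpen)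
      ⟨x, mem_interior_iff_mem_nhds.mpr (hB.1.mem_of_mem trivial), hx⟩
  choose Z hZ hZn hZO hZd using hO
  have hZV : ∀ N n, Disjoint V (Z N n) := fun N n => Set.disjoint_left.mpr fun y hy hyZ =>
    (hZO N n hyZ).2 (Or.inl hy)
  choose k hk hkZ using fun N n => hΓ.compress V (Z N n) hV (hZ N n) (hZn N n) (hZV N n)
  -- Each conjugator is supported on V ∪ Z N n, away from W; hence conjugating b * h by it changes
  -- only b.
  have hkW : ∀ N n, h * k N n = k N n * h := fun N n => by
    refine commute_of_disjoint_support ?_ hh (hk N n)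
    refine Set.disjoint_union_right.mpr ⟨hVW.symm, Set.disjoint_left.mpr fun y hy hyZ =>
      (hZO N n hyZ).2 (Or.inr hy)⟩
  refine hf {g | g • x ≠ x} (fun N i => k N i * b * (k N i)⁻¹) h _ _ ?_ (fun g hg => ?_)
    (fun N i => ?_) (fun N i => hχ.map_conj _ _)
  -- Elements moving x generate: if g fixes x and f moves it, then g = (g f) f⁻¹ is a product of an
  -- element moving x and the inverse of another.
  · have hmove : ∃ f : Γ, f • x ≠ x := by
      obtain ⟨y, -, hy⟩ := (infinite_of_mem_nhds x univ_mem).exists_notMem_finite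
        (Set.finite_singleton x)
      obtain ⟨P, hP, hxP, hPy⟩ := compact_exists_isClopen_in_isOpen
        (isOpen_compl_singleton (x := y)) (Ne.symm hy : x ∈ ({y}ᶜ : Set X))
      obtain ⟨f, -, hf⟩ := hΓ.compress P Pᶜ hP hP.compl ⟨y, fun h => hPy h rfl⟩
        disjoint_compl_right
      exact ⟨f, fun h => hf (Set.smul_mem_smul_set hxP) (h.symm ▸ hxP)⟩
    obtain ⟨f, hf⟩ := hmove
    rw [eq_top_iff]
    intro g _
    by_cases hg : g • x = x
    · have h1 : g * f ∈ Subgroup.closure {g : Γ | g • x ≠ x} := Subgroup.subset_closure (by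
        rw [Set.mem_ofPred_eq, mul_smul]
        intro h
        exact hf (smul_left_cancel g (h.trans hg.symm)))
      have h2 : f ∈ Subgroup.closure {g : Γ | g • x ≠ x} := Subgroup.subset_closure hf
      simpa using mul_mem h1 (inv_mem h2)
    · exact Subgroup.subset_closure hg
  -- There are N + 1 copies, so the commutator sum is at most 2(N + 1), divided by (N + 1)². It
  -- applies once `B N` is so small that g⁻¹ displaces it.
  · have hlim : Tendsto (fun N : ℕ => 2 / ((N : ℝ) + 1)) atTop (𝓝 0) := by
      have := tendsto_one_div_add_atTop_nhds_zero_nat (𝕜 := ℝ)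
      simpa [div_eq_mul_inv] using this.const_mul 2
    refine squeeze_zero_norm' ?_ hlim
    have hg' : g⁻¹ • x ≠ x := fun h => hg (by rw [← inv_smul_eq_iff.mp h])
    obtain ⟨P, Q, hP, hQ, hxP, hxQ, hPQ⟩ := t2_separation hg'.symm
    have hnhds : P ∩ (g⁻¹ • ·) ⁻¹' Q ∈ 𝓝 x :=
      (hP.inter (hQ.preimage (continuous_const_smul g⁻¹))).mem_nhds ⟨hxP, hxQ⟩
    obtain ⟨N₀, -, hN₀⟩ := hB.1.mem_iff.mp hnhds
    filter_upwards [eventually_ge_atTop N₀] with N hN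
    have hBN : B N ⊆ P ∩ (g⁻¹ • ·) ⁻¹' Q := (hB.2 hN).trans hN₀
    have hd : Disjoint (B N) (g⁻¹ • B N) := by
      refine hPQ.mono (fun z hz => (hBN hz).1) ?_
      rintro _ ⟨z, hz, rfl⟩
      exact (hBN hz).2
    have hle := hχ.abs_sum_copies_le hΓ hV hb (k := fun i : Fin (N + 1) => k N i) (O := B N)
      (fun i => (hkZ N i).trans ((hZO N i).trans
        (Set.inter_subset_left.trans interior_subset)))
      (fun i j hij => (hZd N (Fin.val_injective.ne hij)).mono (hkZ N i) (hkZ N j)) hd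
    rw [Fintype.card_fin] at hle
    push_cast at hle
    rw [norm_div, Real.norm_eq_abs, Real.norm_of_nonneg (by positivity),
      div_le_div_iff₀ (by positivity) (by positivity)]
    nlinarith [hle]
  · rw [← hχ.map_conj (k N i) (b * h)]
    congr 1
    have : (k N i)⁻¹ * h = h * (k N i)⁻¹ := by
      rw [inv_mul_eq_iff_eq_mul, ← mul_assoc, ← hkW, mul_inv_cancel_right]
    rw [mul_assoc (k N i * b), this]
    group

end Topological

end SwapRich

/-! ### The dichotomy for factorial characters -/

section Rigidity

open Filter MulAction
open scoped Pointwise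

/-- Divide by n² and let n grow. -/
theorem sq_le_of_forall_sum_le {c t : ℝ}
    (h : ∀ n : ℕ, (n * c) ^ 2 ≤ n ^ 2 * t + n) : c ^ 2 ≤ t := by
  by_contra! hlt
  obtain ⟨n, hn⟩ := exists_nat_one_div_lt (sub_pos.mpr hlt)
  have := h (n + 1)
  rw [div_lt_iff₀ (by positivity)] at hn
  push_cast at this
  nlinarith

variable {Γ : Type u} {X : Type v} [Group Γ] [TopologicalSpace X] [MulAction Γ X]
variable [CompactSpace X] [T2Space X] [TotallyDisconnectedSpace X] [PerfectSpace X]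
variable [ContinuousConstSMul Γ X] {χ : Γ → ℂ}

theorem exists_disjoint_copies (hΓ : IsSwapRich Γ X) {V O : Set X} (hV : IsClopen V)
    (hV1 : V ≠ Set.univ) (hO : IsOpen O) (hne : O.Nonempty) :
    ∃ k : ℕ → Γ, (∀ n, k n • V ⊆ O) ∧ Pairwise (Function.onFun Disjoint fun n => k n • V) := by
  obtain ⟨Z, hZ, hZn, hZO, hZd⟩ := exists_seq_isClopen_disjoint hO hne
  choose k hk using fun n => hΓ.exists_smul_subset hV hV1 (hZ n).isOpen (hZn n)
  exact ⟨k, fun n => (hk n).trans (hZO n), fun m n hmn => (hZd hmn).mono (hk m) (hk n)⟩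

variable [FaithfulSMul Γ X] [FirstCountableTopology X]

/-- If a factorial character does not vanish at some nontrivial element, its absolute value is
bounded below on elements with proper support. -/
theorem IsFactorial.norm_sq_le_norm_pow_four (hΓ : IsSwapRich Γ X) (hχ : IsCharacter χ)
    (hf : IsFactorial χ) {g b : Γ} (hg : g ≠ 1) {V : Set X} (hV : IsClopen V) (hV1 : V ≠ Set.univ)
    (hb : b ∈ fixingSubgroup Γ Vᶜ) : ‖χ g‖ ^ 2 ≤ ‖χ b‖ ^ 4 := by
  obtain ⟨U, hU, hUn, hUd, hUne⟩ := exists_isClopen_displaced (X := X) (inv_ne_one.mpr hg)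
  obtain ⟨k, hkU, hkd⟩ := exists_disjoint_copies hΓ hV hV1 hU.isOpen hUn
  obtain ⟨E, _, _, ξ, hξ⟩ := hχ.exists_inner
  set β : ℕ → Γ := fun n => k n * b * (k n)⁻¹ with hβ
  have hβV : ∀ n, β n ∈ fixingSubgroup Γ (k n • V)ᶜ := fun n =>
    conj_mem_fixingSubgroup_compl hb (k n)
  have hβU : ∀ n, β n ∈ fixingSubgroup Γ Uᶜ := fun n =>
    fixingSubgroup_compl_mono (hkU n) (hβV n)
  have hne : ∀ m n, k m • V ∪ k n • V ≠ Set.univ := fun m n h => by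
    have : U = Set.univ := Set.univ_subset_iff.mp (h ▸ Set.union_subset (hkU m) (hkU n))
    exact hUne (by rw [this, Set.univ_union])
  have hpair : ∀ i j, i ≠ j → ⟪ξ (β i * g * (β i)⁻¹), ξ (β j * g * (β j)⁻¹)⟫_ℂ =
      ((‖χ b‖ ^ 4 : ℝ) : ℂ) := by
    intro i j hij
    have h1 : χ ((β j)⁻¹ * β i) = star (χ b) * χ b := by
      rw [hf.map_mul_of_disjoint hΓ hχ ⟨hV.1.smul (k j), hV.2.smul (k j)⟩
        ⟨hV.1.smul (k i), hV.2.smul (k i)⟩ (hkd hij.symm) (hne j i) (inv_mem (hβV j)) (hβV i),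
        hχ.map_inv, hχ.map_conj, hχ.map_conj]
    have ha : (β j)⁻¹ * β i ∈ fixingSubgroup Γ Uᶜ := mul_mem (inv_mem (hβU j)) (hβU i)
    have ha' := conj_mem_fixingSubgroup_compl (inv_mem ha) g⁻¹
    rw [hξ]
    -- Up to conjugation this is the product of a = (β j)⁻¹ * β i, supported in U, and the conjugate
    -- of a⁻¹ by g⁻¹, supported in g⁻¹ • U; so it evaluates to |χ(a)|².
    calc χ ((β i * g * (β i)⁻¹)⁻¹ * (β j * g * (β j)⁻¹))
        = χ ((β i * g⁻¹ * (β i)⁻¹ * β j * g) * (β j)⁻¹) := by congr 1; group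
      _ = χ (((β j)⁻¹ * β i) * (g⁻¹ * ((β j)⁻¹ * β i)⁻¹ * g⁻¹⁻¹)) := by
        rw [hχ.map_mul_comm]; congr 1; group
      _ = χ ((β j)⁻¹ * β i) * χ (g⁻¹ * ((β j)⁻¹ * β i)⁻¹ * g⁻¹⁻¹) :=
        hf.map_mul_of_disjoint hΓ hχ hU ⟨hU.1.smul g⁻¹, hU.2.smul g⁻¹⟩ hUd hUne ha ha'
      _ = ((‖χ b‖ ^ 4 : ℝ) : ℂ) := by
        rw [hχ.map_conj, hχ.map_inv, h1, star_mul', star_star, ← starRingEnd_apply,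
          Complex.conj_mul', Complex.mul_conj']
        push_cast
        ring
  refine sq_le_of_forall_sum_le fun n => ?_
  set S := ∑ i ∈ Finset.range n, ξ (β i * g * (β i)⁻¹) with hS
  have hS1 : ⟪ξ 1, S⟫_ℂ = n * χ g := by
    simp only [hS, inner_sum, hξ, inv_one, one_mul, hχ.map_conj, Finset.sum_const,
      Finset.card_range, nsmul_eq_mul]
  have hS2 : ‖S‖ ^ 2 ≤ n ^ 2 * ‖χ b‖ ^ 4 + n := by
    rw [← @inner_self_eq_norm_sq ℂ]
    simp only [hS, inner_sum, sum_inner, map_sum]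
    have h2 : ∀ i j, RCLike.re ⟪ξ (β i * g * (β i)⁻¹), ξ (β j * g * (β j)⁻¹)⟫_ℂ ≤
        ‖χ b‖ ^ 4 + if i = j then 1 else 0 := by
      intro i j
      by_cases hij : i = j
      · subst hij
        rw [inner_self_eq_norm_sq, hχ.norm_gram hξ, if_pos rfl]
        linarith [pow_nonneg (norm_nonneg (χ b)) 4]
      · rw [hpair i j hij, if_neg hij, add_zero]
        exact le_of_eq (Complex.ofReal_re _)
    refine (Finset.sum_le_sum fun i _ => Finset.sum_le_sum fun j _ => h2 j i).trans ?_
    simp [Finset.sum_add_distrib, sq, mul_assoc]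
    exact (Finset.card_filter_le _ _).trans (Finset.card_range n).le
  have h3 := norm_inner_le_norm (𝕜 := ℂ) (ξ 1) S
  rw [hS1, hχ.norm_gram hξ, one_mul, norm_mul, Complex.norm_natCast] at h3
  exact (pow_le_pow_left₀ (by positivity) h3 2).trans hS2

/-- Multiplying two disjoint copies squares the absolute value. Both copies are placed in `Y 0`, so
that `Y 1` stays uncovered and the support remains proper. -/
theorem IsFactorial.exists_norm_eq_pow (hΓ : IsSwapRich Γ X) (hχ : IsCharacter χ)
    (hf : IsFactorial χ) {V : Set X} (hV : IsClopen V) (hV1 : V ≠ Set.univ) {b : Γ}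
    (hb : b ∈ fixingSubgroup Γ Vᶜ) (n : ℕ) : ∃ W : Set X, IsClopen W ∧ W ≠ Set.univ ∧
      ∃ c ∈ fixingSubgroup Γ Wᶜ, ‖χ c‖ = ‖χ b‖ ^ 2 ^ n := by
  induction n with
  | zero => exact ⟨V, hV, hV1, b, hb, by simp⟩
  | succ n ih =>
    obtain ⟨W, hW, hW1, c, hc, hcn⟩ := ih
    obtain ⟨z, -⟩ := (Set.ne_univ_iff_exists_notMem W).mp hW1
    obtain ⟨Y, hY, hYn, -, hYd⟩ := exists_seq_isClopen_disjoint isOpen_univ ⟨z, trivial⟩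
    obtain ⟨k, hk, hkd⟩ := exists_disjoint_copies hΓ hW hW1 (hY 0).isOpen (hYn 0)
    have hne : k 0 • W ∪ k 1 • W ≠ Set.univ := by
      obtain ⟨y, hy⟩ := hYn 1
      refine (Set.ne_univ_iff_exists_notMem _).mpr ⟨y, fun h => ?_⟩
      exact (hYd zero_ne_one).notMem_of_mem_right hy (Set.union_subset (hk 0) (hk 1) h)
    have hc0 := conj_mem_fixingSubgroup_compl hc (k 0)
    have hc1 := conj_mem_fixingSubgroup_compl hc (k 1)
    have cl : ∀ i, IsClopen (k i • W) := fun i => ⟨hW.1.smul (k i), hW.2.smul (k i)⟩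
    refine ⟨_, (cl 0).union (cl 1), hne, (k 0 * c * (k 0)⁻¹) * (k 1 * c * (k 1)⁻¹),
      mul_mem (fixingSubgroup_compl_mono Set.subset_union_left hc0)
        (fixingSubgroup_compl_mono Set.subset_union_right hc1), ?_⟩
    rw [hf.map_mul_of_disjoint hΓ hχ (cl 0) (cl 1) (hkd zero_ne_one) hne hc0 hc1, hχ.map_conj,
      hχ.map_conj, norm_mul, hcn, ← pow_add]
    ring_nf

/-- A factorial character of a swap rich group is regular or has absolute value one. -/
theorem IsFactorial.eq_zero_or_norm_eq_one (hΓ : IsSwapRich Γ X) (hχ : IsCharacter χ)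
    (hf : IsFactorial χ) : (∀ g, g ≠ 1 → χ g = 0) ∨ ∀ g, ‖χ g‖ = 1 := by
  refine or_iff_not_imp_left.mpr fun h => ?_
  push Not at h
  obtain ⟨g, hg, hχg⟩ := h
  have hproper : ∀ V : Set X, IsClopen V → V ≠ Set.univ → ∀ b ∈ fixingSubgroup Γ Vᶜ,
      ‖χ b‖ = 1 := by
    intro V hV hV1 b hb
    refine (hχ.norm_le_one b).antisymm (not_lt.mp fun hlt => ?_)
    have hpos : 0 < ‖χ g‖ ^ 2 := by positivity
    obtain ⟨n, hn⟩ := exists_pow_lt_of_lt_one hpos hlt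
    obtain ⟨W, hW, hW1, c, hc, hcn⟩ := hf.exists_norm_eq_pow hΓ hχ hV hV1 hb n
    have h1 := hf.norm_sq_le_norm_pow_four hΓ hχ hg hW hW1 hc
    rw [hcn, ← pow_mul] at h1
    have h2 : ‖χ b‖ ^ (2 ^ n * 4) ≤ ‖χ b‖ ^ n :=
      pow_le_pow_of_le_one (norm_nonneg _) hlt.le
        (n.lt_two_pow_self.le.trans (Nat.le_mul_of_pos_right _ (by norm_num)))
    linarith
  intro f
  by_cases hf1 : f = 1
  · rw [hf1, hχ.map_one, norm_one]
  -- Write f = h * (h⁻¹ * f), where h agrees with f on U: h is supported on the proper set U ∪ f •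
  -- U, and h⁻¹ * f fixes U pointwise.
  obtain ⟨U, hU, ⟨x, hx⟩, hUd, hUne⟩ := exists_isClopen_displaced (X := X) hf1
  obtain ⟨h, hh, heq⟩ := hΓ.swap f U hU hUd
  have h1 := hproper _ (hU.union ⟨hU.1.smul f, hU.2.smul f⟩) hUne h hh
  have h2 := hproper Uᶜ hU.compl (fun h => (h ▸ trivial : x ∈ Uᶜ) hx) (h⁻¹ * f) (by
    rw [compl_compl, mem_fixingSubgroup_iff]
    intro y hy
    rw [mul_smul, ← heq y hy, inv_smul_smul])
  rw [← mul_inv_cancel_left h f, hχ.map_mul_of_norm_eq_one h1, norm_mul, h1, h2, one_mul]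

end Rigidity

/-! ## Topological full groups are swap rich -/

section FullGroup

open Filter MulAction
open scoped Pointwise

section CantorSpace

variable {X : Type u} [TopologicalSpace X]

/-- Flipping the n-th coordinate gives points different from x that converge to x. -/
theorem perfectSpace_of_homeomorph_cantor (c : X ≃ₜ (ℕ → Bool)) : PerfectSpace X := by
  classical
  rw [perfectSpace_iff_forall_not_isolated]
  intro x
  have h : Tendsto (fun n => c.symm (Function.update (c x) n (!(c x n)))) atTop (𝓝[≠] x) := by
    refine tendsto_nhdsWithin_iff.mpr ⟨?_, Eventually.of_forall fun n => ?_⟩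
    · have : Tendsto (fun n => Function.update (c x) n (!(c x n))) atTop (𝓝 (c x)) := by
        refine tendsto_pi_nhds.mpr fun m => tendsto_const_nhds.congr' ?_
        filter_upwards [eventually_gt_atTop m] with n hn
        rw [Function.update_of_ne hn.ne]
      have := (c.symm.continuous.tendsto (c x)).comp this
      rwa [c.symm_apply_apply] at this
    · intro h
      have h2 := congrFun (c.symm_apply_eq.mp h) n
      simp at h2
  exact h.neBot

end CantorSpace

/-! ### Maps given by continuous local sections -/

variable {X : Type u} [Groupoid.{v} X] [TopologicalSpace X] [TopologicalSpace (Arrows X)]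

/-- On `V`, the map `f` is given by the ranges of a continuous section of the source map. -/
def IsLocalSectionMap (V : Set X) (f : X → X) : Prop :=
  ∃ σ : X → Arrows X, ContinuousOn σ V ∧ ∀ x ∈ V, src (σ x) = x ∧ rng (σ x) = f x

theorem IsLocalSectionMap.mono {V W : Set X} {f : X → X} (h : IsLocalSectionMap W f)
    (hVW : V ⊆ W) : IsLocalSectionMap V f :=
  let ⟨σ, hσ, h⟩ := h
  ⟨σ, hσ.mono hVW, fun x hx => h x (hVW hx)⟩

theorem IsLocalSectionMap.congr {V : Set X} {f g : X → X} (h : IsLocalSectionMap V f)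
    (hfg : Set.EqOn f g V) : IsLocalSectionMap V g :=
  let ⟨σ, hσ, h⟩ := h
  ⟨σ, hσ, fun x hx => ⟨(h x hx).1, (h x hx).2.trans (hfg hx)⟩⟩

theorem IsLocalSectionMap.union {V W : Set X} {f : X → X} (hV : IsLocalSectionMap V f)
    (hW : IsLocalSectionMap W f) (hVo : IsOpen V) (hWo : IsOpen W) (hd : Disjoint V W) :
    IsLocalSectionMap (V ∪ W) f := by
  classical
  obtain ⟨σ, hσ, hσ'⟩ := hV
  obtain ⟨τ, hτ, hτ'⟩ := hW
  have e1 : Set.EqOn (V.piecewise σ τ) σ V := Set.piecewise_eqOn V σ τ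
  have e2 : Set.EqOn (V.piecewise σ τ) τ W := fun x hx =>
    Set.piecewise_eq_of_notMem _ _ _ (hd.notMem_of_mem_right hx)
  refine ⟨V.piecewise σ τ, (hσ.congr e1).union_of_isOpen (hτ.congr e2) hVo hWo, ?_⟩
  rintro x (hx | hx)
  · rw [e1 hx]; exact hσ' x hx
  · rw [e2 hx]; exact hτ' x hx

variable [CantorGroupoid X]

theorem isLocalSectionMap_id (V : Set X) : IsLocalSectionMap V id :=
  ⟨unitArrow, CantorGroupoid.continuous_unit.continuousOn, fun _ _ => ⟨rfl, rfl⟩⟩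

theorem IsLocalSectionMap.continuousOn {V : Set X} {f : X → X} (h : IsLocalSectionMap V f) :
    ContinuousOn f V := by
  obtain ⟨σ, hσ, h⟩ := h
  exact (CantorGroupoid.etale_rng.continuous.comp_continuousOn hσ).congr fun x hx => (h x hx).2.symm

theorem IsLocalSectionMap.comp {V W : Set X} {f g : X → X} (hg : IsLocalSectionMap W g)
    (hf : IsLocalSectionMap V f) (hfV : Set.MapsTo f V W) : IsLocalSectionMap V (g ∘ f) := by
  classical
  have hfc := hf.continuousOn
  obtain ⟨τ, hτ, hτ'⟩ := hg
  obtain ⟨σ, hσ, hσ'⟩ := hf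
  have hcomp : ∀ x ∈ V, src (τ (f x)) = rng (σ x) := fun x hx =>
    (hτ' _ (hfV hx)).1.trans (hσ' x hx).2.symm
  -- Outside V the two arrows need not be composable; the unit is a dummy value there.
  refine ⟨fun x => if hx : x ∈ V then mulArrow ⟨(τ (f x), σ x), hcomp x hx⟩ else unitArrow x, ?_,
    fun x hx => ?_⟩
  · rw [continuousOn_iff_continuous_domRestrict]
    have e : V.domRestrict (fun x => if hx : x ∈ V then mulArrow ⟨(τ (f x), σ x), hcomp x hx⟩
        else unitArrow x) = fun x : V => mulArrow ⟨(τ (f x), σ x), hcomp x x.2⟩ := by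
      ext1 x
      simp [Set.domRestrict]
    rw [e]
    refine CantorGroupoid.continuous_mul.comp (Continuous.subtype_mk (Continuous.prodMk ?_ ?_) _)
    · exact (continuousOn_iff_continuous_domRestrict.mp (hτ.comp hfc hfV))
    · exact (continuousOn_iff_continuous_domRestrict.mp hσ)
  · simp only [dif_pos hx]
    exact ⟨(hσ' x hx).1, (hτ' _ (hfV hx)).2⟩

/-- A continuous section of the local homeomorphism `src` over an open set is an open embedding, and
`rng` is open. -/
theorem IsLocalSectionMap.isOpen_image {V U : Set X} {f : X → X} (h : IsLocalSectionMap V f)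
    (hU : IsOpen U) (hUV : U ⊆ V) : IsOpen (f '' U) := by
  obtain ⟨σ, hσ, h⟩ := h.mono hUV
  have hs : src ∘ U.domRestrict σ = Subtype.val := funext fun x => (h x x.2).1
  have hr : rng ∘ U.domRestrict σ = f ∘ Subtype.val := funext fun x => (h x x.2).2
  have hopen : IsOpenEmbedding (U.domRestrict σ) :=
    CantorGroupoid.etale_src.isOpenEmbedding_of_comp (hs ▸ hU.isOpenEmbedding_subtypeVal)
      (continuousOn_iff_continuous_domRestrict.mp hσ)
  have := (CantorGroupoid.etale_rng.isOpenMap.comp hopen.isOpenMap).isOpen_range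
  rwa [hr, Set.range_comp, Subtype.range_coe] at this

/-- Inverting the arrows of the section of f gives one for h; continuity of h on the image comes
from openness of f. -/
theorem IsLocalSectionMap.symm {V : Set X} {f h : X → X} (hf : IsLocalSectionMap V f)
    (hV : IsOpen V) (hh : ∀ x ∈ V, h (f x) = x) : IsLocalSectionMap (f '' V) h := by
  have hhc : ContinuousOn h (f '' V) := by
    rintro _ ⟨x, hx, rfl⟩
    intro O hO
    rw [hh x hx] at hO
    obtain ⟨O', hO', hO'o, hxO'⟩ := mem_nhds_iff.mp hO
    refine mem_nhdsWithin_of_mem_nhds (mem_of_superset ((hf.isOpen_image (hO'o.inter hV)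
      Set.inter_subset_right).mem_nhds ⟨x, ⟨hxO', hx⟩, rfl⟩) ?_)
    rintro _ ⟨y, hy, rfl⟩
    rw [Set.mem_preimage, hh y hy.2]
    exact hO' hy.1
  obtain ⟨σ, hσ, hσ'⟩ := hf
  refine ⟨fun y => invArrow (σ (h y)), CantorGroupoid.continuous_inv.comp_continuousOn
    (hσ.comp hhc ?_), ?_⟩
  · rintro _ ⟨x, hx, rfl⟩
    rwa [hh x hx]
  · rintro _ ⟨x, hx, rfl⟩
    change src (invArrow (σ (h (f x)))) = f x ∧ rng (invArrow (σ (h (f x)))) = h (f x)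
    rw [hh x hx]
    exact ⟨(hσ' x hx).2, (hσ' x hx).1⟩

/-- The swap of `V` and `f(V)`. -/
theorem exists_mem_topologicalFullGroup_swap [CompactSpace X] [T2Space X] {V : Set X} {f : X → X} (hV : IsClopen V)
    (hf : IsLocalSectionMap V f) (hinj : Set.InjOn f V) (hd : Disjoint V (f '' V)) :
    ∃ g ∈ topologicalFullGroup X, (∀ x ∈ V, g x = f x) ∧ ∀ x ∉ V ∪ f '' V, g x = x := by
  classical
  rcases V.eq_empty_or_nonempty with rfl | ⟨x₀, hx₀⟩
  · exact ⟨1, one_mem _, by simp, by simp⟩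
  have : Nonempty X := ⟨x₀⟩
  let h := Function.invFunOn f V
  have hh : ∀ x ∈ V, h (f x) = x := fun x hx => hinj.leftInvOn_invFunOn hx
  have hW : IsClopen (f '' V) :=
    ⟨(hV.1.isCompact.image_of_continuousOn hf.continuousOn).isClosed,
      hf.isOpen_image hV.2 subset_rfl⟩
  let s : X → X := fun x => if x ∈ V then f x else if x ∈ f '' V then h x else x
  have s1 : ∀ x ∈ V, s x = f x := fun x hx => if_pos hx
  have s2 : ∀ x ∈ V, s (f x) = x := fun x hx => by
    have h1 : f x ∈ f '' V := ⟨x, hx, rfl⟩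
    simp only [s, if_neg (hd.notMem_of_mem_right h1), if_pos h1, hh x hx]
  have s3 : ∀ x ∉ V ∪ f '' V, s x = x := fun x hx => by
    rw [Set.mem_union, not_or] at hx
    simp only [s, if_neg hx.1, if_neg hx.2]
  have hs : Function.Involutive s := fun x => by
    by_cases hx : x ∈ V
    · rw [s1 x hx, s2 x hx]
    by_cases hx' : x ∈ f '' V
    · obtain ⟨y, hy, rfl⟩ := hx'
      rw [s2 y hy, s1 y hy]
    · have := s3 x (by rw [Set.mem_union, not_or]; exact ⟨hx, hx'⟩)
      rw [this, this]
  -- Glue f on V, its inverse on f(V), and the identity on the clopen remainder. As s is an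
  -- involution, its continuity already makes it a homeomorphism.
  have hsec : IsLocalSectionMap Set.univ s := by
    have h1 := (hf.congr fun x hx => (s1 x hx).symm).union
      ((hf.symm hV.2 hh).congr (by rintro _ ⟨x, hx, rfl⟩; rw [s2 x hx, hh x hx])) hV.2 hW.2 hd
    have h2 := h1.union ((isLocalSectionMap_id (V ∪ f '' V)ᶜ).congr fun x hx => (s3 x hx).symm)
      (hV.union hW).isOpen (hV.union hW).compl.isOpen disjoint_compl_right
    rwa [Set.union_compl_self] at h2
  have hc : Continuous s := continuousOn_univ.mp hsec.continuousOn
  refine ⟨⟨hs.toPerm, hc, hc⟩, ?_, s1, s3⟩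
  change ∃ B, _
  rw [exists_isInducedBy_iff]
  obtain ⟨σ, hσ, hσ'⟩ := hsec
  exact ⟨σ, continuousOn_univ.mp hσ, fun x => hσ' x trivial⟩

/-- The map is the range map after the inverse of the source map on B. -/
theorem IsCompactOpenBisection.exists_isLocalSectionMap {B : Set (Arrows X)}
    (hB : IsCompactOpenBisection B) : ∃ f : X → X, IsLocalSectionMap (src '' B) f ∧
      Set.InjOn f (src '' B) ∧ f '' (src '' B) = rng '' B := by
  classical
  have hsi : Set.InjOn src B := Set.injOn_iff_injective.mpr hB.src_restrict.injective
  have hri : Set.InjOn rng B := Set.injOn_iff_injective.mpr hB.rng_restrict.injective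
  have hex : ∀ x : X, ∃ γ : Arrows X, x ∈ src '' B → γ ∈ B ∧ src γ = x := fun x => by
    by_cases hx : x ∈ src '' B
    · obtain ⟨γ, hγ⟩ := hx
      exact ⟨γ, fun _ => hγ⟩
    · exact ⟨unitArrow x, fun h => absurd h hx⟩
  choose σ hσ' using hex
  have hσB : ∀ x ∈ src '' B, σ x ∈ B := fun x hx => (hσ' x hx).1
  have hσ : ∀ x ∈ src '' B, src (σ x) = x := fun x hx => (hσ' x hx).2
  have hσs : ∀ γ ∈ B, σ (src γ) = γ := fun γ hγ =>
    hsi (hσB _ ⟨γ, hγ, rfl⟩) hγ (hσ _ ⟨γ, hγ, rfl⟩)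
  refine ⟨fun x => rng (σ x), ⟨σ, ?_, fun x hx => ⟨hσ x hx, rfl⟩⟩, ?_, ?_⟩
  · rintro _ ⟨γ, hγ, rfl⟩
    intro O hO
    rw [hσs γ hγ] at hO
    obtain ⟨O', hO', hO'o, hγO'⟩ := mem_nhds_iff.mp hO
    refine mem_nhdsWithin_of_mem_nhds (mem_of_superset ((CantorGroupoid.etale_src.isOpenMap _
      (hO'o.inter hB.isOpen)).mem_nhds ⟨γ, ⟨hγO', hγ⟩, rfl⟩) ?_)
    rintro _ ⟨δ, hδ, rfl⟩
    rw [Set.mem_preimage, hσs δ hδ.2]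
    exact hO' hδ.1
  · rintro _ ⟨γ, hγ, rfl⟩ _ ⟨δ, hδ, rfl⟩ h
    simp only [hσs γ hγ, hσs δ hδ] at h
    rw [hri hγ hδ h]
  · rw [Set.image_image]
    exact Set.image_congr fun γ hγ => by rw [hσs γ hγ]

/-- Every point has a clopen neighbourhood that is mapped into a given nonempty open set by a
bisection. -/
theorem exists_nhds_isLocalSectionMap [CompactSpace X] [T2Space X] [TotallyDisconnectedSpace X]
    (hmin : IsMinimalGroupoid X) {Z : Set X} (hZ : IsOpen Z) (hne : Z.Nonempty) (x : X) :
    ∃ V : Set X, IsClopen V ∧ x ∈ V ∧ ∃ f, IsLocalSectionMap V f ∧ Set.InjOn f V ∧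
      Set.MapsTo f V Z := by
  -- A dense orbit supplies an arrow γ from x into Z; near it `src` has a continuous local inverse,
  -- and `rng` is injective.
  obtain ⟨y, hyZ, γ, rfl, rfl⟩ := (hmin x).inter_open_nonempty Z hZ hne
  obtain ⟨e, hγe, he⟩ := CantorGroupoid.etale_src γ
  obtain ⟨e', hγe', he'⟩ := CantorGroupoid.etale_rng γ
  have hx : src γ ∈ e.target := by rw [he]; exact e.map_source hγe
  have hγ : e.symm (src γ) = γ := by rw [he]; exact e.left_inv hγe
  have hO : IsOpen (e.target ∩ e.symm ⁻¹' (e'.source ∩ rng ⁻¹' Z)) :=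
    e.symm.isOpen_inter_preimage (e'.open_source.inter
      (hZ.preimage CantorGroupoid.etale_rng.continuous))
  obtain ⟨V, hV, hxV, hVO⟩ := compact_exists_isClopen_in_isOpen hO
    ⟨hx, by rw [Set.mem_preimage, hγ]; exact ⟨hγe', hyZ⟩⟩
  refine ⟨V, hV, hxV, fun x => rng (e.symm x), ⟨e.symm, e.symm.continuousOn.mono fun x hx =>
    (hVO hx).1, fun x hx => ⟨?_, rfl⟩⟩, fun x hx z hz h => ?_, fun x hx => (hVO hx).2.2⟩
  · rw [he]; exact e.right_inv (hVO hx).1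
  · have h1 : e.symm x = e.symm z := by
      rw [he'] at h
      exact e'.injOn (hVO hx).2.1 (hVO hz).2.1 h
    exact e.symm.injOn (hVO hx).1 (hVO hz).1 h1

/-- Z contains two disjoint copies j(Z) and j'(Z) of itself. Embeddings f of W and g of Y into Z
therefore combine into one of W ∪ Y, using j ∘ f on W and j' ∘ g on Y \ W; compactness of V does the
rest. -/
theorem exists_isLocalSectionMap_mapsTo [CompactSpace X] [T2Space X] [TotallyDisconnectedSpace X]
    (hmin : IsMinimalGroupoid X) (hpi : IsPurelyInfiniteGroupoid X) {V Z : Set X}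
    (hV : IsClopen V) (hZ : IsClopen Z) (hne : Z.Nonempty) :
    ∃ f, IsLocalSectionMap V f ∧ Set.InjOn f V ∧ Set.MapsTo f V Z := by
  classical
  obtain ⟨B, B', hB, hB', hBs, hBs', hd, hBr, hBr'⟩ := hpi Z hZ.1.isCompact hZ.2
  obtain ⟨j, hj, hji, hjB⟩ := hB.exists_isLocalSectionMap
  obtain ⟨j', hj', hji', hjB'⟩ := hB'.exists_isLocalSectionMap
  rw [hBs] at hj hji hjB
  rw [hBs'] at hj' hji' hjB'
  have hjZ : Set.MapsTo j Z (rng '' B) := hjB ▸ Set.mapsTo_image j Z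
  have hjZ' : Set.MapsTo j' Z (rng '' B') := hjB' ▸ Set.mapsTo_image j' Z
  -- Compact induction ranges over arbitrary subsets, so the property is phrased with a clopen
  -- superset.
  suffices ∃ W : Set X, IsClopen W ∧ V ⊆ W ∧ ∃ f, IsLocalSectionMap W f ∧ Set.InjOn f W ∧
      Set.MapsTo f W Z by
    obtain ⟨W, -, hVW, f, hf, hfi, hfZ⟩ := this
    exact ⟨f, hf.mono hVW, hfi.mono hVW, hfZ.mono_left hVW⟩
  refine hV.1.isCompact.induction_on (p := fun V => ∃ W : Set X, IsClopen W ∧ V ⊆ W ∧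
    ∃ f, IsLocalSectionMap W f ∧ Set.InjOn f W ∧ Set.MapsTo f W Z) ?_ ?_ ?_ ?_
  · exact ⟨∅, isClopen_empty, subset_rfl, id, isLocalSectionMap_id _, Set.injOn_empty _,
      Set.mapsTo_empty _ _⟩
  · rintro s t hst ⟨W, hW, htW, h⟩
    exact ⟨W, hW, hst.trans htW, h⟩
  · rintro s t ⟨W, hW, hsW, f, hf, hfi, hfZ⟩ ⟨Y, hY, htY, g, hg, hgi, hgZ⟩
    have e1 : Set.EqOn (W.piecewise (j ∘ f) (j' ∘ g)) (j ∘ f) W := Set.piecewise_eqOn _ _ _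
    have e2 : Set.EqOn (W.piecewise (j ∘ f) (j' ∘ g)) (j' ∘ g) (Y \ W) := fun x hx =>
      Set.piecewise_eq_of_notMem _ _ _ hx.2
    have hYW : Y \ W ⊆ Y := Set.sdiff_subset
    have m1 : Set.MapsTo (W.piecewise (j ∘ f) (j' ∘ g)) W (rng '' B) :=
      (hjZ.comp hfZ).congr e1.symm
    have m2 : Set.MapsTo (W.piecewise (j ∘ f) (j' ∘ g)) (Y \ W) (rng '' B') :=
      (hjZ'.comp (hgZ.mono_left hYW)).congr e2.symm
    refine ⟨W ∪ Y \ W, hW.union (hY.diff hW), ?_, W.piecewise (j ∘ f) (j' ∘ g),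
      ((hj.comp hf hfZ).congr e1.symm).union
        ((hj'.comp (hg.mono hYW) (hgZ.mono_left hYW)).congr e2.symm) hW.2 (hY.diff hW).2
        Set.disjoint_sdiff_right, ?_, ?_⟩
    · rw [Set.union_sdiff_self]
      exact Set.union_subset_union hsW htY
    · rw [Set.injOn_union Set.disjoint_sdiff_right]
      exact ⟨(hji.comp hfi hfZ).congr e1.symm,
        (hji'.comp (hgi.mono hYW) (hgZ.mono_left hYW)).congr e2.symm,
        fun x hx y hy h => (hd.ne_of_mem (m1 hx) (m2 hy)) h⟩
    · exact (m1.mono_right hBr).union (m2.mono_right hBr')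
  · intro x _
    obtain ⟨W, hW, hxW, f, hf⟩ := exists_nhds_isLocalSectionMap hmin hZ.2 hne x
    exact ⟨W, mem_nhdsWithin_of_mem_nhds (hW.2.mem_nhds hxW), W, hW, subset_rfl, f, hf⟩

/-! ### The action of the topological full group -/

instance : MulAction (topologicalFullGroup X) X where
  smul g x := (g : X ≃ₜ X) x
  one_smul _ := rfl
  mul_smul _ _ _ := rfl

instance : FaithfulSMul (topologicalFullGroup X) X :=
  ⟨fun h => Subtype.ext (Homeomorph.ext h)⟩

instance : ContinuousConstSMul (topologicalFullGroup X) X :=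
  ⟨fun g => (g : X ≃ₜ X).continuous⟩

theorem isSwapRich_topologicalFullGroup [CompactSpace X] [T2Space X] [TotallyDisconnectedSpace X]
    (hmin : IsMinimalGroupoid X) (hpi : IsPurelyInfiniteGroupoid X) :
    IsSwapRich (topologicalFullGroup X) X where
  swap g U hU hd := by
    obtain ⟨σ, hσ, hσ'⟩ := (exists_isInducedBy_iff _).mp g.2
    obtain ⟨h, hh, h1, h2⟩ := exists_mem_topologicalFullGroup_swap hU ⟨σ, hσ.continuousOn, fun x _ => hσ' x⟩
      (g : X ≃ₜ X).injective.injOn hd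
    exact ⟨⟨h, hh⟩, (mem_fixingSubgroup_iff _).mpr h2, h1⟩
  compress V Z hV hZ hne hd := by
    obtain ⟨f, hf, hfi, hfZ⟩ := exists_isLocalSectionMap_mapsTo hmin hpi hV hZ hne
    obtain ⟨h, hh, h1, h2⟩ := exists_mem_topologicalFullGroup_swap hV hf hfi (hd.mono_right hfZ.image_subset)
    refine ⟨⟨h, hh⟩, (mem_fixingSubgroup_iff _).mpr fun x hx => h2 x fun hx' => hx
      (Set.union_subset_union_right V hfZ.image_subset hx'), ?_⟩
    rintro _ ⟨x, hx, rfl⟩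
    change h x ∈ Z
    rw [h1 x hx]
    exact hfZ hx

/-- Factorial characters of topological full groups. -/
theorem IsFactorial.eq_regularCharacter_or_norm_eq_one (hmin : IsMinimalGroupoid X)
    (hpi : IsPurelyInfiniteGroupoid X) {χ : topologicalFullGroup X → ℂ} (hχ : IsCharacter χ)
    (hf : IsFactorial χ) :
    χ = regularCharacter (topologicalFullGroup X) ∨ ∀ g, ‖χ g‖ = 1 := by
  obtain ⟨c⟩ := CantorGroupoid.cantor (X := X)
  have : CompactSpace X := c.symm.compactSpace
  have : T2Space X := c.isEmbedding.t2Space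
  have : TotallyDisconnectedSpace X := c.symm.totallyDisconnectedSpace
  have : PerfectSpace X := perfectSpace_of_homeomorph_cantor c
  have : FirstCountableTopology X := c.isInducing.firstCountableTopology
  refine (hf.eq_zero_or_norm_eq_one (isSwapRich_topologicalFullGroup hmin hpi) hχ).imp_left
    fun h => funext fun g => ?_
  by_cases hg : g = 1
  · simp [regularCharacter, hg, hχ.map_one]
  · simp [regularCharacter, hg, h g hg]

end FullGroup

/-! ## Traces of finite factor representations -/

section FiniteFactor

open Filter

variable {Γ : Type u} [Group Γ]
variable {H : Type w} [NormedAddCommGroup H] [InnerProductSpace ℂ H] [CompleteSpace H]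

/-- Limits of contractions in the weak operator topology along ultrafilters. -/
theorem exists_weak_limit {α : Type*} (U : Ultrafilter α) (A : α → H →L[ℂ] H)
    (hA : ∀ a, ‖A a‖ ≤ 1) :
    ∃ T : H →L[ℂ] H, ∀ x y, Tendsto (fun a => ⟪A a x, y⟫_ℂ) U (𝓝 ⟪T x, y⟫_ℂ) := by
  have hb : ∀ x y a, ‖⟪A a x, y⟫_ℂ‖ ≤ ‖x‖ * ‖y‖ := fun x y a => by
    refine (norm_inner_le_norm _ _).trans ?_
    gcongr
    exact ((A a).le_of_opNorm_le (hA a) x).trans (one_mul _).le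
  choose L hL using fun x y => exists_tendsto_ultrafilter U (hb x y)
  -- The limits form a bounded sesquilinear form, which Fréchet-Riesz represents by an operator.
  let f : H →ₗ⋆[ℂ] H →ₗ[ℂ] ℂ := LinearMap.mk₂'ₛₗ (starRingEnd ℂ) (RingHom.id ℂ) L
    (fun x x' y => tendsto_nhds_unique (hL _ _)
      (((hL x y).add (hL x' y)).congr fun a => by rw [map_add, inner_add_left]))
    (fun c x y => tendsto_nhds_unique (hL _ _)
      (((hL x y).const_mul (starRingEnd ℂ c)).congr fun a => by rw [map_smul, inner_smul_left]))
    (fun x y y' => tendsto_nhds_unique (hL _ _)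
      (((hL x y).add (hL x y')).congr fun a => by rw [inner_add_right]))
    (fun c x y => tendsto_nhds_unique (hL _ _)
      (((hL x y).const_mul c).congr fun a => by rw [inner_smul_right]))
  let F := f.mkContinuous₂ 1 fun x y => by
    rw [one_mul]
    exact le_of_tendsto (hL x y).norm (Eventually.of_forall (hb x y))
  refine ⟨InnerProductSpace.continuousLinearMapOfBilin F, fun x y => ?_⟩
  rw [InnerProductSpace.continuousLinearMapOfBilin_apply]
  exact hL x y

section Trace

variable {M : VonNeumannAlgebra H} {τ : M.toStarSubalgebra →ₗ[ℂ] ℂ}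

theorem IsFaithfulNormalTracialState.map_star (hτ : IsFaithfulNormalTracialState M τ)
    (a : M.toStarSubalgebra) : τ (star a) = star (τ a) := by
  obtain ⟨ξ, -, h⟩ := hτ.normal
  refine (h (star a)).unique ?_
  convert (h a).star using 2 with n
  change ⟪ξ n, ContinuousLinearMap.adjoint (a : H →L[ℂ] H) (ξ n)⟫_ℂ = _
  rw [ContinuousLinearMap.adjoint_inner_right, ← starRingEnd_apply, inner_conj_symm]

/-- The trace as an inner product. -/
theorem IsFaithfulNormalTracialState.exists_inner (hτ : IsFaithfulNormalTracialState M τ) :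
    ∃ (E : Type w) (_ : SeminormedAddCommGroup E) (_ : InnerProductSpace ℂ E)
      (Λ : M.toStarSubalgebra →ₗ[ℂ] E), ∀ a b, ⟪Λ a, Λ b⟫_ℂ = τ (star a * b) := by
  let core : PreInnerProductSpace.Core ℂ M.toStarSubalgebra :=
    { inner a b := τ (star a * b)
      conj_inner_symm a b := by
        rw [starRingEnd_apply, ← hτ.map_star, star_mul, star_star]
      re_inner_nonneg a := (RCLike.nonneg_iff.mp (hτ.nonneg a)).1
      add_left a b c := by rw [star_add, add_mul, map_add]
      smul_left a b c := by rw [star_smul, smul_mul_assoc, map_smul]; rfl }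
  let s := @InnerProductSpace.Core.toSeminormedAddCommGroup ℂ _ _ _ _ core
  let i := InnerProductSpace.ofCore core
  exact ⟨M.toStarSubalgebra, s, i,
    { toFun a := a, map_add' _ _ := rfl, map_smul' _ _ := rfl }, fun a b => rfl⟩

/-- The trace is continuous for weak limits of contractions. -/
theorem IsFaithfulNormalTracialState.tendsto_mul (hτ : IsFaithfulNormalTracialState M τ)
    {α : Type*} {U : Filter α} {A : α → M.toStarSubalgebra} {T : M.toStarSubalgebra}
    (hA : ∀ a, ‖(A a : H →L[ℂ] H)‖ ≤ 1)
    (hT : ∀ x y, Tendsto (fun a => ⟪(A a : H →L[ℂ] H) x, y⟫_ℂ) U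
      (𝓝 ⟪(T : H →L[ℂ] H) x, y⟫_ℂ)) (b : M.toStarSubalgebra) :
    Tendsto (fun a => τ (b * A a)) U (𝓝 (τ (b * T))) := by
  obtain ⟨ξ, hξ, h⟩ := hτ.normal
  -- Moving b to the other side makes each summand a matrix coefficient of c, so weak convergence
  -- applies termwise, dominated by ‖ξ n‖² times the norm of the adjoint of b.
  have e : ∀ c : M.toStarSubalgebra, τ (b * c) = ∑' n, star
      ⟪(c : H →L[ℂ] H) (ξ n), ContinuousLinearMap.adjoint (b : H →L[ℂ] H) (ξ n)⟫_ℂ := fun c => by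
    rw [← (h (b * c)).tsum_eq]
    refine tsum_congr fun n => ?_
    rw [← starRingEnd_apply, inner_conj_symm, ContinuousLinearMap.adjoint_inner_left]
    rfl
  simp only [e]
  refine tendsto_tsum_of_dominated_convergence (bound := fun n => ‖ξ n‖ ^ 2 *
    ‖ContinuousLinearMap.adjoint (b : H →L[ℂ] H)‖) (hξ.mul_right _)
    (fun n => (hT _ _).star) (Eventually.of_forall fun a n => ?_)
  rw [norm_star]
  refine (norm_inner_le_norm _ _).trans ?_
  have h1 := (A a : H →L[ℂ] H).le_of_opNorm_le (hA a) (ξ n)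
  have h2 := (ContinuousLinearMap.adjoint (b : H →L[ℂ] H)).le_opNorm (ξ n)
  rw [one_mul] at h1
  calc _ ≤ ‖ξ n‖ * (‖ContinuousLinearMap.adjoint (b : H →L[ℂ] H)‖ * ‖ξ n‖) :=
        mul_le_mul h1 h2 (norm_nonneg _) (norm_nonneg _)
    _ = _ := by ring

end Trace

/-! ### The character of a finite factor representation -/

variable {π : Γ →* unitary (H →L[ℂ] H)}

theorem repElement_one : repElement π 1 = 1 := Subtype.ext (by simp [repElement])

theorem repElement_mul (g h : Γ) : repElement π (g * h) = repElement π g * repElement π h :=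
  Subtype.ext (by simp [repElement])

theorem star_repElement (g : Γ) : star (repElement π g) = repElement π g⁻¹ :=
  Subtype.ext (by
    change star (π g : H →L[ℂ] H) = (π g⁻¹ : H →L[ℂ] H)
    rw [_root_.map_inv, ← Unitary.star_eq_inv, Unitary.coe_star])

theorem norm_repElement_le (g : Γ) : ‖(repElement π g : H →L[ℂ] H)‖ ≤ 1 :=
  ContinuousLinearMap.opNorm_le_bound _ zero_le_one fun x =>
    ((ContinuousLinearMap.norm_map_of_mem_unitary (π g).2 x).trans (one_mul _).symm).le

variable {τ : (repVonNeumannAlgebra π).toStarSubalgebra →ₗ[ℂ] ℂ}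

theorem IsFaithfulNormalTracialState.isCharacter
    (hτ : IsFaithfulNormalTracialState (repVonNeumannAlgebra π) τ) :
    IsCharacter fun g => τ (repElement π g) := by
  obtain ⟨E, _, _, Λ, hΛ⟩ := hτ.exists_inner
  refine ⟨fun g h => ?_, by rw [repElement_one, hτ.map_one], fun n g => ?_⟩
  · simp only [repElement_mul, hτ.tracial (repElement π g)]
  · exact posSemidef_of_inner (χ := fun g => τ (repElement π g))
      (ξ := fun g => Λ (repElement π g))
      (fun g h => by rw [hΛ, star_repElement, repElement_mul]) n g

/-- The averages have a weak limit t in π(Γ)'' that commutes with π(Γ); it is central, hence a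
scalar, and normality carries the trace identities to the limit. -/
theorem IsFaithfulNormalTracialState.isFactorial
    (hτ : IsFaithfulNormalTracialState (repVonNeumannAlgebra π) τ)
    (hπ : IsVNFactor (repVonNeumannAlgebra π)) : IsFactorial fun g => τ (repElement π g) := by
  intro S s h p q hS hs hp hq
  have hχ := hτ.isCharacter
  obtain ⟨E, _, _, Λ, hΛ⟩ := hτ.exists_inner
  have hξ : ∀ g h, ⟪Λ (repElement π g), Λ (repElement π h)⟫_ℂ = τ (repElement π (g⁻¹ * h)) :=
    fun g h => by rw [hΛ, star_repElement, repElement_mul]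
  let U : Ultrafilter ℕ := hyperfilter ℕ
  have hU : (U : Filter ℕ) ≤ atTop := Nat.hyperfilter_le_atTop
  let A : ℕ → (repVonNeumannAlgebra π).toStarSubalgebra := fun N =>
    ((N : ℂ) + 1)⁻¹ • ∑ i, repElement π (s N i)
  have hN1 : ∀ N : ℕ, ‖((N : ℂ) + 1)⁻¹‖ = ((N : ℝ) + 1)⁻¹ := fun N => by
    rw [norm_inv, ← Nat.cast_succ, Complex.norm_natCast, Nat.cast_succ]
  have hA : ∀ N, ‖(A N : H →L[ℂ] H)‖ ≤ 1 := fun N => by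
    change ‖((N : ℂ) + 1)⁻¹ • ((∑ i, repElement π (s N i) :
      (repVonNeumannAlgebra π).toStarSubalgebra) : H →L[ℂ] H)‖ ≤ 1
    rw [norm_smul, hN1, inv_mul_le_iff₀ (by positivity), AddSubmonoidClass.coe_finsetSum]
    refine (norm_sum_le_of_le _ fun i _ => norm_repElement_le (s N i)).trans (by simp)
  obtain ⟨T, hT⟩ := exists_weak_limit U (fun N => (A N : H →L[ℂ] H)) hA
  have hTM : T ∈ (repVonNeumannAlgebra π).toStarSubalgebra := by
    change T ∈ Set.centralizer (Set.centralizer (repOperators π))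
    intro c hc
    refine ContinuousLinearMap.ext fun x => ext_inner_right ℂ fun y => ?_
    change ⟪c (T x), y⟫_ℂ = ⟪T (c x), y⟫_ℂ
    rw [← ContinuousLinearMap.adjoint_inner_right]
    refine tendsto_nhds_unique (hT x _) ((hT (c x) y).congr fun N => ?_)
    have := (A N).2 c hc
    rw [ContinuousLinearMap.adjoint_inner_right]
    exact congrArg (fun z : H →L[ℂ] H => ⟪z x, y⟫_ℂ) this.symm
  let t : (repVonNeumannAlgebra π).toStarSubalgebra := ⟨T, hTM⟩
  have hlim := fun b => hτ.tendsto_mul (T := t) hA hT b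
  have hcomm : ∀ g, t * repElement π g = repElement π g * t := by
    intro g
    have hg : g ∈ Subgroup.closure S := hS ▸ Subgroup.mem_top g
    induction hg using Subgroup.closure_induction with
    | mem g hg =>
      -- Traciality rewrites the pairing so that the limit occurs in one factor only, where
      -- normality applies; Cauchy-Schwarz bounds it by the 2-norm of the commutator. Faithfulness
      -- then concludes, taking b to be the adjoint of the commutator.
      have h0 : ∀ b, τ (b * (t * repElement π g - repElement π g * t)) = 0 := fun b => by
        have e1 : ∀ c, τ (b * (c * repElement π g - repElement π g * c)) =
            τ ((repElement π g * b - b * repElement π g) * c) := fun c => by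
          rw [mul_sub, sub_mul, map_sub, map_sub, ← mul_assoc, hτ.tracial (b * c), mul_assoc,
            mul_assoc]
        rw [e1]
        refine tendsto_nhds_unique (hlim _) (Tendsto.mono_left ?_ hU)
        have h1 : Tendsto (fun N : ℕ => ‖Λ (star b)‖ * √(2 * ((∑ i, ∑ j,
            (τ (repElement π ((s N i)⁻¹ * s N j)) - τ (repElement π (g⁻¹ * (s N i)⁻¹ * g *
              s N j)))).re / ((N : ℝ) + 1) ^ 2))) atTop (𝓝 0) := by
          simpa using ((hs g hg).const_mul 2).sqrt.const_mul ‖Λ (star b)‖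
        refine squeeze_zero_norm (fun N => ?_) h1
        rw [← mul_div_assoc, ← hχ.norm_sum_sub_sq hξ, ← div_pow, Real.sqrt_sq (by positivity),
          ← e1]
        have e2 : A N * repElement π g - repElement π g * A N = ((N : ℂ) + 1)⁻¹ •
            (∑ i, repElement π (s N i * g) - ∑ i, repElement π (g * s N i)) := by
          simp only [A, repElement_mul, smul_mul_assoc, mul_smul_comm, Finset.sum_mul,
            Finset.mul_sum, smul_sub]
        have e3 := hΛ (star b) (A N * repElement π g - repElement π g * A N)
        rw [star_star] at e3
        rw [← e3]
        refine (norm_inner_le_norm _ _).trans (le_of_eq ?_)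
        rw [e2, map_smul, norm_smul, hN1, map_sub, map_sum, map_sum]
        ring
      exact sub_eq_zero.mp (hτ.faithful _ (h0 _))
    | one => rw [repElement_one, mul_one, one_mul]
    | mul a b _ _ ha hb =>
      rw [repElement_mul, ← mul_assoc, ha, mul_assoc, hb, mul_assoc]
    | inv a _ ha =>
      have e1 : repElement π a * repElement π a⁻¹ = 1 := by
        rw [← repElement_mul, mul_inv_cancel, repElement_one]
      have e2 : repElement π a⁻¹ * repElement π a = 1 := by
        rw [← repElement_mul, inv_mul_cancel, repElement_one]
      calc t * repElement π a⁻¹ = repElement π a⁻¹ * (repElement π a * t) * repElement π a⁻¹ := by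
            rw [← mul_assoc (repElement π a⁻¹), e2, one_mul]
        _ = repElement π a⁻¹ * t := by
            rw [← ha, mul_assoc, mul_assoc, e1, mul_one]
  have hTc : T ∈ Set.range fun c : ℂ => c • (1 : H →L[ℂ] H) := by
    rw [← hπ]
    refine ⟨hTM, ?_⟩
    rw [SetLike.mem_coe, VonNeumannAlgebra.mem_commutant_iff]
    have hTc : T ∈ Set.centralizer (repOperators π) := by
      rintro _ ⟨g, rfl⟩
      exact congrArg Subtype.val (hcomm g).symm
    intro m hm
    exact (hm T hTc).symm
  obtain ⟨c, hc⟩ := hTc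
  have ht : t = c • 1 := Subtype.ext hc.symm
  have hval : ∀ (g : Γ) (r : ℂ), (∀ N i, τ (repElement π (s N i * g)) = r) →
      r = c * τ (repElement π g) := fun g r hr => by
    have h1 := hlim (repElement π g)
    rw [ht, mul_smul_comm, mul_one, map_smul, smul_eq_mul] at h1
    refine tendsto_nhds_unique (tendsto_const_nhds.congr fun N => ?_) h1
    have : (N : ℂ) + 1 ≠ 0 := by exact_mod_cast N.succ_ne_zero
    have hr' : ∀ i, τ (repElement π (g * s N i)) = r := fun i => by
      rw [repElement_mul, hτ.tracial, ← repElement_mul, hr]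
    simp only [A, mul_smul_comm, Finset.mul_sum, map_smul, map_sum, ← repElement_mul, hr']
    simp
    field_simp
  have h1 := hval 1 q (by simpa using hq)
  rw [repElement_one, hτ.map_one, mul_one] at h1
  rw [h1]
  exact hval h p hp

/-- The squared 2-norm of π(g) - τ(π(g)) is 1 - |τ(π(g))|² = 0, and τ is faithful. -/
theorem IsFaithfulNormalTracialState.rep_eq_smul
    (hτ : IsFaithfulNormalTracialState (repVonNeumannAlgebra π) τ) {g : Γ}
    (hg : ‖τ (repElement π g)‖ = 1) :
    (π g : H →L[ℂ] H) = τ (repElement π g) • (1 : H →L[ℂ] H) := by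
  have h : repElement π g - τ (repElement π g) • 1 = 0 := by
    apply hτ.faithful
    have h1 : star (repElement π g) * repElement π g = 1 := by
      rw [star_repElement, ← repElement_mul, inv_mul_cancel, repElement_one]
    have h2 : star (τ (repElement π g)) * τ (repElement π g) = 1 := by
      rw [← starRingEnd_apply, Complex.conj_mul', hg]; simp
    simp only [star_sub, star_smul, star_one, sub_mul, mul_sub, h1, smul_mul_assoc, mul_smul_comm,
      one_mul, mul_one, map_sub, map_smul, hτ.map_one, hτ.map_star, smul_eq_mul]
    linear_combination -h2
  exact congrArg Subtype.val (sub_eq_zero.mp h)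

end FiniteFactor

theorem mainTheorem5 {X : Type u} [Groupoid.{v} X] [TopologicalSpace X]
    [TopologicalSpace (Arrows X)] [CantorGroupoid X]
    (hG_eff : IsEffectiveGroupoid X) (hG_min : IsMinimalGroupoid X)
    (hG_pi : IsPurelyInfiniteGroupoid X) :
    (∀ χ : topologicalFullGroup X → ℂ, IsIndecomposableCharacter χ →
      χ = regularCharacter (topologicalFullGroup X) ∨
        ∃ ρ : Abelianization (topologicalFullGroup X) →* Circle,
          ∀ g, χ g = (ρ (Abelianization.of g) : ℂ)) ∧
    (∀ (H : Type w) [NormedAddCommGroup H] [InnerProductSpace ℂ H] [CompleteSpace H]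
      (π : topologicalFullGroup X →* unitary (H →L[ℂ] H)), IsFiniteFactorRep π →
      HasRegularCharacter π ∨
        ∃ ρ : Abelianization (topologicalFullGroup X) →* Circle,
          ∀ g, (π g : H →L[ℂ] H) = (ρ (Abelianization.of g) : ℂ) • (1 : H →L[ℂ] H)) := by
  refine ⟨fun χ hχ => ?_, fun H _ _ _ π hπ => or_iff_not_imp_left.mpr fun hreg => ?_⟩
  · exact (hχ.isFactorial.eq_regularCharacter_or_norm_eq_one hG_min hG_pi hχ.1).imp_right
      hχ.1.exists_monoidHom
  · simp only [HasRegularCharacter, not_forall] at hreg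
    obtain ⟨τ, hτ, g₀, hg₀⟩ := hreg
    have h1 := ((hτ.isFactorial hπ.1).eq_regularCharacter_or_norm_eq_one hG_min hG_pi
      hτ.isCharacter).resolve_left fun h => hg₀ (congrFun h g₀)
    obtain ⟨ρ, hρ⟩ := hτ.isCharacter.exists_monoidHom h1
    exact ⟨ρ, fun g => by rw [← hρ]; exact hτ.rep_eq_smul (h1 g)⟩
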